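/- Let $R$ be a commutative ring. For a free $R$-module $A$ let $L^*(A)$ be the free Lie algebra over $R$ generated by the module $A$, and let $L^m(A)\subseteq L^*(A)$, $m\ge 1$, be the submodule generated by the $m$-fold commutators of elements of $A$. The Chevalley–Eilenberg complex of a Lie algebra $\mathfrak g$ has components $\Lambda^i\mathfrak g$ and differential $$d(x_1\wedge\dots\wedge x_i)=\sum_{s<t}(-1)^{s+t}[x_s,x_t]\wedge x_1\wedge\dots\wedge\hat x_s\wedge\dots\wedge\hat x_t\wedge\dots\wedge x_i .$$ For $\mathfrak g=L^*(A)$ let $\mathsf C^{(n)}_i(A)\subseteq\Lambda^i L^*(A)$ be the span of the elements $x_1\wedge\dots\wedge x_i$ with $x_s\in L^{m_s}(A)$ and $m_1+\dots+m_i=n$. These submodules form a subcomplex $\mathsf C^{(n)}_\bullet(A)$, natural in $A$; thus $\mathsf C^{(n)}_\bullet$ is a chain complex of functors from the category of free $R$-modules to the category of $R$-modules. Let $n\ge 2$. Then: 1. the complex $\mathsf C^{(n)}_\bullet$ is acyclic, i.e. exact in every degree; 2. for every $i\ge 0$, exterior multiplication in $\Lambda L^*(A)$ induces an isomorphism of functors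 $$\bigoplus_{\substack{k_1+\dots+k_n=i\\ k_1\cdot 1+k_2\cdot 2+\dots+k_n\cdot n=n}}\Lambda^{k_1}L^1\otimes\Lambda^{k_2}L^2\otimes\dots\otimes\Lambda^{k_n}L^n\;\cong\;\mathsf C^{(n)}_i ,$$ where the sum runs over the ordered $n$-tuples $(k_1,\dots,k_n)$ of non-negative integers with the two stated properties, and $\Lambda^{k}L^{j}$ is the functor $A\mapsto\Lambda^{k}(L^{j}(A))$; 3. $\mathsf C^{(n)}_i=0$ for $i\notin\{1,\dots,n\}$, and the inclusions $A\to L^*(A)$ and $L^n(A)\to L^*(A)$ induce isomorphisms of functors $\Lambda^n\cong\mathsf C^{(n)}_n$ and $L^n\cong\mathsf C^{(n)}_1$. So $\mathsf C^{(n)}_\bullet$ is an exact sequence $$0\to\Lambda^n\to\dots\to L^n\to 0 .$$ -/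

import Mathlib

open CategoryTheory
open scoped DirectSum TensorProduct

universe u v w w'

noncomputable section

namespace GradedCE

/-! ### The Chevalley–Eilenberg differential on the exterior algebra of a Lie algebra -/

section Differential

variable (R : Type u) [CommRing R] {𝔤 : Type w} [LieRing 𝔤] [LieAlgebra R 𝔤]

local notation "ιΛ" => ExteriorAlgebra.ι R

/-- One step of the recursion `θ_x (y ∧ ω) = [x, y] ∧ ω + y ∧ θ_x ω`. -/
def adExtStep (x : 𝔤) :
    𝔤 →ₗ[R] ExteriorAlgebra R 𝔤 × ExteriorAlgebra R 𝔤 →ₗ[R] ExteriorAlgebra R 𝔤 :=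
  LinearMap.mk₂ R (fun y p => ιΛ ⁅x, y⁆ * p.1 + ιΛ y * p.2)
    (fun y z p => by simp only [lie_add, map_add, add_mul]; abel)
    (fun r y p => by simp only [lie_smul, map_smul, smul_mul_assoc, smul_add])
    (fun y p q => by simp only [Prod.fst_add, Prod.snd_add, mul_add]; abel)
    (fun r y p => by simp only [Prod.smul_fst, Prod.smul_snd, mul_smul_comm, smul_add])

theorem adExtStep_adExtStep (x y : 𝔤) (ω fω : ExteriorAlgebra R 𝔤) :
    adExtStep R x y (CliffordAlgebra.ι (0 : QuadraticForm R 𝔤) y * ω, adExtStep R x y (ω, fω)) =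
      (0 : QuadraticForm R 𝔤) y • fω := by
  have h := ExteriorAlgebra.ι_add_mul_swap (R := R) ⁅x, y⁆ y
  have h' := ExteriorAlgebra.ι_sq_zero (R := R) y
  change ιΛ ⁅x, y⁆ * (ιΛ y * ω) + ιΛ y * (ιΛ ⁅x, y⁆ * ω + ιΛ y * fω) = (0 : R) • fω
  rw [zero_smul, mul_add, ← mul_assoc, ← mul_assoc, ← mul_assoc, h', zero_mul, add_zero,
    ← add_mul, h, zero_mul]

/-- The action of `x : 𝔤` on `Λ 𝔤`, the derivation that extends `y ↦ [x, y]`. -/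
def adExtAux (x : 𝔤) : ExteriorAlgebra R 𝔤 →ₗ[R] ExteriorAlgebra R 𝔤 :=
  CliffordAlgebra.foldr' (0 : QuadraticForm R 𝔤) (adExtStep R x) (adExtStep_adExtStep R x) 0

variable {R} in
/-- Induction on exterior algebras: multiply by vectors on the left. -/
theorem ext_induction {M : Type w} [AddCommGroup M] [Module R M]
    {P : ExteriorAlgebra R M → Prop} (one : P 1)
    (add : ∀ a b, P a → P b → P (a + b)) (smul : ∀ (r : R) a, P a → P (r • a))
    (mul : ∀ x a, P a → P (ExteriorAlgebra.ι R x * a)) (a : ExteriorAlgebra R M) : P a := by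
  refine CliffordAlgebra.left_induction (Q := (0 : QuadraticForm R M)) (P := P) ?_ add ?_ a
  · intro r
    rw [Algebra.algebraMap_eq_smul_one]
    exact smul r 1 one
  · intro x m h
    exact mul m x h

theorem adExtAux_one (x : 𝔤) : adExtAux R x 1 = 0 := by
  have := CliffordAlgebra.foldr'_algebraMap (0 : QuadraticForm R 𝔤) (adExtStep R x)
    (adExtStep_adExtStep R x) 0 1
  rw [map_one, smul_zero] at this
  exact this

theorem adExtAux_ι_mul (x y : 𝔤) (ω : ExteriorAlgebra R 𝔤) :
    adExtAux R x (ιΛ y * ω) = ιΛ ⁅x, y⁆ * ω + ιΛ y * adExtAux R x ω :=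
  CliffordAlgebra.foldr'_ι_mul (0 : QuadraticForm R 𝔤) _ _ _ _ _

/-- The action of `𝔤` on `Λ 𝔤` by derivations that extends the adjoint action. -/
def adExt : 𝔤 →ₗ[R] ExteriorAlgebra R 𝔤 →ₗ[R] ExteriorAlgebra R 𝔤 where
  toFun := adExtAux R
  map_add' x y := by
    refine LinearMap.ext fun ω => ?_
    induction ω using ext_induction with
    | one => simp [adExtAux_one]
    | add a b ha hb => rw [map_add, ha, hb, map_add]
    | smul r a ha => rw [map_smul, ha, map_smul]
    | mul z a ha =>
      rw [adExtAux_ι_mul, ha]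
      simp only [LinearMap.add_apply, adExtAux_ι_mul, add_lie, map_add, add_mul, mul_add]
      abel
  map_smul' r x := by
    refine LinearMap.ext fun ω => ?_
    induction ω using ext_induction with
    | one => simp [adExtAux_one]
    | add a b ha hb => rw [map_add, ha, hb, map_add]
    | smul r a ha => rw [map_smul, ha, map_smul]
    | mul z a ha =>
      rw [adExtAux_ι_mul, ha]
      simp only [LinearMap.smul_apply, adExtAux_ι_mul, smul_lie, map_smul, smul_mul_assoc,
        mul_smul_comm, smul_add, RingHom.id_apply]

@[simp] theorem adExt_one (x : 𝔤) : adExt R x 1 = 0 := adExtAux_one R x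

theorem adExt_ι_mul (x y : 𝔤) (ω : ExteriorAlgebra R 𝔤) :
    adExt R x (ιΛ y * ω) = ιΛ ⁅x, y⁆ * ω + ιΛ y * adExt R x ω :=
  adExtAux_ι_mul R x y ω

/-- One step of the recursion `d (x ∧ ω) = - (x ∧ d ω) - θ_x ω`. -/
def dStep : 𝔤 →ₗ[R] ExteriorAlgebra R 𝔤 × ExteriorAlgebra R 𝔤 →ₗ[R] ExteriorAlgebra R 𝔤 :=
  LinearMap.mk₂ R (fun x p => -(ιΛ x * p.2) - adExt R x p.1)
    (fun y z p => by simp only [map_add, add_mul, LinearMap.add_apply]; abel)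
    (fun r y p => by
      simp only [map_smul, smul_mul_assoc, smul_sub, smul_neg, LinearMap.smul_apply])
    (fun y p q => by simp only [Prod.fst_add, Prod.snd_add, mul_add, map_add]; abel)
    (fun r y p => by
      simp only [Prod.smul_fst, Prod.smul_snd, mul_smul_comm, smul_sub, smul_neg, map_smul])

theorem dStep_dStep (x : 𝔤) (ω fω : ExteriorAlgebra R 𝔤) :
    dStep R x (CliffordAlgebra.ι (0 : QuadraticForm R 𝔤) x * ω, dStep R x (ω, fω)) =
      (0 : QuadraticForm R 𝔤) x • fω := by
  have h' := ExteriorAlgebra.ι_sq_zero (R := R) x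
  change -(ιΛ x * (-(ιΛ x * fω) - adExt R x ω)) - adExt R x (ιΛ x * ω) = (0 : R) • fω
  rw [adExt_ι_mul, lie_self, map_zero, zero_mul, zero_add, zero_smul, mul_sub, mul_neg,
    ← mul_assoc, h', zero_mul]
  abel

/-- The Chevalley–Eilenberg differential (trivial coefficients) on `Λ 𝔤`; see `d_ιMulti` for the
closed formula. -/
def d : ExteriorAlgebra R 𝔤 →ₗ[R] ExteriorAlgebra R 𝔤 :=
  CliffordAlgebra.foldr' (0 : QuadraticForm R 𝔤) (dStep R) (dStep_dStep R) 0

theorem d_one : d R (1 : ExteriorAlgebra R 𝔤) = 0 := by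
  have := CliffordAlgebra.foldr'_algebraMap (0 : QuadraticForm R 𝔤) (dStep R)
    (dStep_dStep R) 0 1
  rw [map_one, smul_zero] at this
  exact this

theorem d_ι_mul (x : 𝔤) (ω : ExteriorAlgebra R 𝔤) :
    d R (ιΛ x * ω) = -(ιΛ x * d R ω) - adExt R x ω :=
  CliffordAlgebra.foldr'_ι_mul (0 : QuadraticForm R 𝔤) _ _ _ _ _

theorem adExt_lie (x y : 𝔤) (ω : ExteriorAlgebra R 𝔤) :
    adExt R ⁅x, y⁆ ω = adExt R x (adExt R y ω) - adExt R y (adExt R x ω) := by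
  induction ω using ext_induction with
  | one => simp
  | add a b ha hb => simp only [map_add, ha, hb]; abel
  | smul r a ha => simp only [map_smul, ha, smul_sub]
  | mul z a ha =>
    simp only [adExt_ι_mul, ha, map_add, lie_lie, map_sub, sub_mul, mul_sub]
    abel

theorem adExt_d (x : 𝔤) (ω : ExteriorAlgebra R 𝔤) : adExt R x (d R ω) = d R (adExt R x ω) := by
  induction ω using ext_induction with
  | one => simp [d_one]
  | add a b ha hb => simp only [map_add, ha, hb]
  | smul r a ha => simp only [map_smul, ha]
  | mul z a ha =>
    simp only [adExt_ι_mul, d_ι_mul, map_add, map_sub, map_neg, ha, adExt_lie]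
    abel

theorem d_d (ω : ExteriorAlgebra R 𝔤) : d R (d R ω) = 0 := by
  induction ω using ext_induction with
  | one => simp [d_one]
  | add a b ha hb => simp only [map_add, ha, hb, add_zero]
  | smul r a ha => simp only [map_smul, ha, smul_zero]
  | mul z a ha =>
    simp only [d_ι_mul, map_sub, map_neg, ha, adExt_d, mul_zero]
    abel

theorem ιMulti_succ {M : Type w} [AddCommGroup M] [Module R M] {m : ℕ} (x : Fin (m + 1) → M) :
    ExteriorAlgebra.ιMulti R (m + 1) x =
      ExteriorAlgebra.ι R (x 0) * ExteriorAlgebra.ιMulti R m (fun k => x k.succ) :=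
  ExteriorAlgebra.ιMulti_succ_apply x

theorem adExt_ιMulti (a : 𝔤) {m : ℕ} (x : Fin (m + 1) → 𝔤) :
    adExt R a (ExteriorAlgebra.ιMulti R (m + 1) x) =
      ∑ t : Fin (m + 1), (-1 : R) ^ (t : ℕ) •
        (ιΛ ⁅a, x t⁆ * ExteriorAlgebra.ιMulti R m (fun k => x (t.succAbove k))) := by
  induction m with
  | zero => simp [ExteriorAlgebra.ιMulti_zero_apply, adExt_ι_mul, -mul_one]
  | succ m ih =>
    rw [ιMulti_succ, adExt_ι_mul, Fin.sum_univ_succ]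
    congr 1
    · simp
    · rw [ih, Finset.mul_sum]
      refine Finset.sum_congr rfl fun t _ => ?_
      rw [ιMulti_succ R (fun k => x (t.succ.succAbove k)), mul_smul_comm,
        ← mul_assoc, ← mul_assoc, Fin.val_succ, pow_succ]
      have h := ExteriorAlgebra.ι_add_mul_swap (R := R) (x 0) ⁅a, x t.succ⁆
      rw [eq_neg_of_add_eq_zero_left h]
      simp

/-- The closed formula for the differential, with `s < t + 1` for the two contracted positions:
`d (x₀ ∧ … ∧ xᵢ₊₁) = ∑_{s < t'} (-1) ^ (s + t') [x_s, x_t'] ∧ x₀ ∧ … x̂_s … x̂_t' … ∧ xᵢ₊₁`. -/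
theorem d_ιMulti {i : ℕ} (x : Fin (i + 2) → 𝔤) :
    d R (ExteriorAlgebra.ιMulti R (i + 2) x) =
      ∑ s : Fin (i + 1), ∑ t : Fin (i + 1), if s ≤ t then
        (-1 : R) ^ ((s.castSucc : ℕ) + (t.succ : ℕ)) •
          (ιΛ ⁅x s.castSucc, x t.succ⁆ *
            ExteriorAlgebra.ιMulti R i (fun k => x (t.succ.succAbove (s.succAbove k))))
      else 0 := by
  induction i with
  | zero =>
    rw [ιMulti_succ, d_ι_mul, adExt_ιMulti, ιMulti_succ, d_ι_mul]
    simp [d_one]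
  | succ i ih =>
    rw [ιMulti_succ, d_ι_mul, Fin.sum_univ_succ, ih, adExt_ιMulti, sub_eq_add_neg, add_comm]
    congr 1
    · rw [← Finset.sum_neg_distrib]
      refine Finset.sum_congr rfl fun t _ => ?_
      simp [pow_succ]
    · rw [Finset.mul_sum, ← Finset.sum_neg_distrib]
      refine Finset.sum_congr rfl fun s _ => ?_
      rw [Fin.sum_univ_succ (n := i + 1), if_neg (by simp), zero_add, Finset.mul_sum, ← Finset.sum_neg_distrib]
      refine Finset.sum_congr rfl fun t _ => ?_
      by_cases hst : s ≤ t
      · rw [if_pos hst, if_pos (by simpa using hst),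
          ιMulti_succ R (fun k => x (t.succ.succ.succAbove (s.succ.succAbove k))), mul_smul_comm,
          ← mul_assoc, ← mul_assoc]
        have h := ExteriorAlgebra.ι_add_mul_swap (R := R) (x 0) ⁅x s.castSucc.succ, x t.succ.succ⁆
        rw [eq_neg_of_add_eq_zero_left h]
        simp [pow_add, pow_succ]
      · rw [if_neg hst, if_neg (by simpa using hst), mul_zero, neg_zero]

/-- The differential commutes with the maps induced by homomorphisms of Lie algebras. -/
theorem map_adExt {𝔥 : Type w} [LieRing 𝔥] [LieAlgebra R 𝔥] (φ : 𝔤 →ₗ⁅R⁆ 𝔥) (x : 𝔤)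
    (ω : ExteriorAlgebra R 𝔤) :
    ExteriorAlgebra.map (φ : 𝔤 →ₗ[R] 𝔥) (adExt R x ω) =
      adExt R (φ x) (ExteriorAlgebra.map (φ : 𝔤 →ₗ[R] 𝔥) ω) := by
  induction ω using ext_induction with
  | one => simp
  | add a b ha hb => simp only [map_add, ha, hb]
  | smul r a ha => simp only [map_smul, ha]
  | mul z a ha =>
    simp only [adExt_ι_mul, map_add, map_mul, ExteriorAlgebra.map_apply_ι, ha,
      LieHom.coe_toLinearMap, LieHom.map_lie]

theorem map_d {𝔥 : Type w} [LieRing 𝔥] [LieAlgebra R 𝔥] (φ : 𝔤 →ₗ⁅R⁆ 𝔥)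
    (ω : ExteriorAlgebra R 𝔤) :
    ExteriorAlgebra.map (φ : 𝔤 →ₗ[R] 𝔥) (d R ω) =
      d R (ExteriorAlgebra.map (φ : 𝔤 →ₗ[R] 𝔥) ω) := by
  induction ω using ext_induction with
  | one => simp [d_one]
  | add a b ha hb => simp only [map_add, ha, hb]
  | smul r a ha => simp only [map_smul, ha]
  | mul z a ha =>
    simp only [d_ι_mul, map_sub, map_neg, map_mul, ExteriorAlgebra.map_apply_ι, ha,
      LieHom.coe_toLinearMap, map_adExt]

end Differential

/-! ### The graded pieces of the Chevalley–Eilenberg complex -/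

section Graded

variable (R : Type u) [CommRing R] {𝔤 : Type w} [LieRing 𝔤] [LieAlgebra R 𝔤]

/-- The span in `Λ^i 𝔤 ⊆ Λ 𝔤` of the elements `x₁ ∧ … ∧ xᵢ` with `xₖ` homogeneous of degree
`deg k` and `deg 1 + … + deg i = n`. -/
def cePart (𝒢 : ℕ → Submodule R 𝔤) (n i : ℕ) : Submodule R (ExteriorAlgebra R 𝔤) :=
  Submodule.span R {ω | ∃ (x : Fin i → 𝔤) (deg : Fin i → ℕ),
    (∀ k, x k ∈ 𝒢 (deg k)) ∧ ∑ k, deg k = n ∧ ExteriorAlgebra.ιMulti R i x = ω}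

/-- `cePart R 𝒢 n i` lies in the exterior power `Λ^i 𝔤`. -/
theorem cePart_le (𝒢 : ℕ → Submodule R 𝔤) (n i : ℕ) : cePart R 𝒢 n i ≤ ⋀[R]^i 𝔤 := by
  refine Submodule.span_le.2 ?_
  rintro _ ⟨x, -, -, -, rfl⟩
  exact ExteriorAlgebra.ιMulti_range R i ⟨x, rfl⟩

theorem d_mem (𝒢 : ℕ → Submodule R 𝔤) [SetLike.GradedBracket 𝒢] (n i : ℕ)
    (ω : ExteriorAlgebra R 𝔤) (hω : ω ∈ cePart R 𝒢 n (i + 1)) : d R ω ∈ cePart R 𝒢 n i := by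
  refine (Submodule.span_le.2 ?_ : cePart R 𝒢 n (i + 1) ≤ (cePart R 𝒢 n i).comap (d R)) hω
  rintro _ ⟨x, deg, hx, hdeg, rfl⟩
  change d R _ ∈ cePart R 𝒢 n i
  cases i with
  | zero =>
    have : d R (ExteriorAlgebra.ιMulti R (0 + 1) x) = 0 := by
      rw [ιMulti_succ, d_ι_mul, ExteriorAlgebra.ιMulti_zero_apply, d_one, adExt_one]
      simp
    rw [this]
    exact zero_mem _
  | succ i =>
    rw [d_ιMulti]
    refine Submodule.sum_mem _ fun s _ => Submodule.sum_mem _ fun t _ => ?_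
    split_ifs with hst
    · refine Submodule.smul_mem _ _ (Submodule.subset_span ?_)
      refine ⟨Fin.cons ⁅x s.castSucc, x t.succ⁆
          (fun k => x (t.succ.succAbove (s.succAbove k))),
        Fin.cons (deg s.castSucc + deg t.succ)
          (fun k => deg (t.succ.succAbove (s.succAbove k))), ?_, ?_, ?_⟩
      · intro k
        refine Fin.cases ?_ (fun k => ?_) k
        · exact SetLike.GradedBracket.bracket_mem (ℒ := 𝒢) (hx _) (hx _)
        · exact hx _
      · rw [Fin.sum_univ_succ]
        simp only [Fin.cons_zero, Fin.cons_succ]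
        rw [← hdeg, Fin.sum_univ_succAbove deg t.succ,
          Fin.sum_univ_succAbove (fun k => deg (t.succ.succAbove k)) s,
          Fin.succAbove_of_castSucc_lt t.succ s
            (Fin.castSucc_lt_succ_iff.2 hst)]
        ring
      · rw [ιMulti_succ]
        simp
    · exact zero_mem _

theorem map_mem {𝔥 : Type w} [LieRing 𝔥] [LieAlgebra R 𝔥] (𝒢 : ℕ → Submodule R 𝔤)
    (ℋ : ℕ → Submodule R 𝔥) (f : 𝔤 →ₗ[R] 𝔥) (hf : ∀ m, ∀ x ∈ 𝒢 m, f x ∈ ℋ m) (n i : ℕ)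
    (ω : ExteriorAlgebra R 𝔤) (hω : ω ∈ cePart R 𝒢 n i) :
    (ExteriorAlgebra.map f).toLinearMap ω ∈ cePart R ℋ n i := by
  refine (Submodule.span_le.2 ?_ :
    cePart R 𝒢 n i ≤ (cePart R ℋ n i).comap (ExteriorAlgebra.map f).toLinearMap) hω
  rintro _ ⟨x, deg, hx, hdeg, rfl⟩
  exact Submodule.subset_span ⟨f ∘ x, deg, fun k => hf _ _ (hx k), hdeg,
    (ExteriorAlgebra.map_apply_ιMulti f x).symm⟩

end Graded

/-! ### The free Lie algebra generated by a module, and Lie powers -/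

section FreeLie

variable (R : Type u) [CommRing R] (A : Type v) [AddCommGroup A] [Module R A]

/-- The linearity relations between the generators of the free Lie algebra on the set `A`. -/
def linRel : Set (FreeLieAlgebra R A) :=
  {z | ∃ a b : A, z = FreeLieAlgebra.of R (a + b) -
      (FreeLieAlgebra.of R a + FreeLieAlgebra.of R b)} ∪
    {z | ∃ (r : R) (a : A), z = FreeLieAlgebra.of R (r • a) - r • FreeLieAlgebra.of R a}

/-- The free Lie algebra `L^*(A)` generated by the module `A`: the free Lie algebra on the set `A`
modulo the ideal generated by the linearity relations. Its universal property is `FreeLie.lift`. -/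
def FreeLie : Type (max u v) :=
  FreeLieAlgebra R A ⧸ (LieSubmodule.lieSpan R (FreeLieAlgebra R A) (linRel R A))

namespace FreeLie

instance : LieRing (FreeLie R A) :=
  inferInstanceAs (LieRing (FreeLieAlgebra R A ⧸ _))

instance : LieAlgebra R (FreeLie R A) :=
  inferInstanceAs (LieAlgebra R (FreeLieAlgebra R A ⧸ _))

/-- The quotient map from the free Lie algebra on the set `A`. -/
def mk : FreeLieAlgebra R A →ₗ⁅R⁆ FreeLie R A where
  toFun z := (LieSubmodule.Quotient.mk z : FreeLieAlgebra R A ⧸ _)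
  map_add' _ _ := rfl
  map_smul' _ _ := rfl
  map_lie' := rfl

theorem mk_surjective : Function.Surjective (mk R A) :=
  LieSubmodule.Quotient.surjective_mk' _

theorem mk_eq_zero {z : FreeLieAlgebra R A} (hz : z ∈ linRel R A) : mk R A z = 0 :=
  LieSubmodule.Quotient.mk_eq_zero'.2 (LieSubmodule.subset_lieSpan hz)

/-- The universal linear map from `A` to the free Lie algebra. -/
def of : A →ₗ[R] FreeLie R A where
  toFun a := mk R A (FreeLieAlgebra.of R a)
  map_add' a b := by
    rw [← map_add, ← sub_eq_zero, ← map_sub]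
    exact mk_eq_zero R A (Or.inl ⟨a, b, rfl⟩)
  map_smul' r a := by
    rw [RingHom.id_apply, ← map_smul, ← sub_eq_zero, ← map_sub]
    exact mk_eq_zero R A (Or.inr ⟨r, a, rfl⟩)

variable {R A}

@[ext]
theorem hom_ext {𝔤 : Type w} [LieRing 𝔤] [LieAlgebra R 𝔤] {φ ψ : FreeLie R A →ₗ⁅R⁆ 𝔤}
    (h : ∀ a, φ (of R A a) = ψ (of R A a)) : φ = ψ := by
  have h' : φ.comp (mk R A) = ψ.comp (mk R A) := FreeLieAlgebra.hom_ext h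
  ext z
  obtain ⟨z, rfl⟩ := mk_surjective R A z
  exact LieHom.congr_fun h' z

/-- The extension of a linear map from `A` to a Lie algebra to a homomorphism of Lie algebras. -/
def lift {𝔤 : Type w} [LieRing 𝔤] [LieAlgebra R 𝔤] (f : A →ₗ[R] 𝔤) : FreeLie R A →ₗ⁅R⁆ 𝔤 :=
  have h : LieSubmodule.lieSpan R (FreeLieAlgebra R A) (linRel R A) ≤
      (FreeLieAlgebra.lift R (f : A → 𝔤)).ker := by
    refine LieSubmodule.lieSpan_le.2 ?_
    rintro _ (⟨a, b, rfl⟩ | ⟨r, a, rfl⟩) <;> simp [LieHom.mem_ker]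
  let g : FreeLie R A →ₗ[R] 𝔤 := Submodule.liftQ _
    (FreeLieAlgebra.lift R (f : A → 𝔤) : FreeLieAlgebra R A →ₗ[R] 𝔤) h
  { g with
    map_lie' := by
      intro x y
      obtain ⟨x, rfl⟩ := mk_surjective R A x
      obtain ⟨y, rfl⟩ := mk_surjective R A y
      exact (FreeLieAlgebra.lift R (f : A → 𝔤)).map_lie x y }

@[simp] theorem lift_of {𝔤 : Type w} [LieRing 𝔤] [LieAlgebra R 𝔤] (f : A →ₗ[R] 𝔤) (a : A) :
    lift f (of R A a) = f a :=
  FreeLieAlgebra.lift_of_apply (R := R) (f : A → 𝔤) a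

/-- The homomorphism of free Lie algebras induced by a linear map. -/
def map {B : Type v} [AddCommGroup B] [Module R B] (f : A →ₗ[R] B) :
    FreeLie R A →ₗ⁅R⁆ FreeLie R B :=
  lift (of R B ∘ₗ f)

@[simp] theorem map_of {B : Type v} [AddCommGroup B] [Module R B] (f : A →ₗ[R] B) (a : A) :
    map f (of R A a) = of R B (f a) :=
  lift_of _ a

theorem map_id : map (LinearMap.id : A →ₗ[R] A) = LieHom.id := by
  ext a
  simp

theorem map_comp {B C : Type v} [AddCommGroup B] [Module R B] [AddCommGroup C] [Module R C]
    (g : B →ₗ[R] C) (f : A →ₗ[R] B) : map (g ∘ₗ f) = (map g).comp (map f) := by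
  ext a
  simp

end FreeLie

/-- `IsCommutator R A n z`: the element `z` is an `n`-fold commutator (with any bracketing) of
elements of `A`. -/
inductive IsCommutator : ℕ → FreeLie R A → Prop
  | of (a : A) : IsCommutator 1 (FreeLie.of R A a)
  | lie {m n : ℕ} {x y : FreeLie R A} :
      IsCommutator m x → IsCommutator n y → IsCommutator (m + n) ⁅x, y⁆

/-- The Lie power `L^n(A)`: the submodule of the free Lie algebra generated by the `n`-fold
commutators. -/
def liePower (n : ℕ) : Submodule R (FreeLie R A) :=
  Submodule.span R {z | IsCommutator R A n z}

/-- There are no `0`-fold commutators: the grading starts in degree `1`. -/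
theorem liePower_zero : liePower R A 0 = ⊥ := by
  have h : ∀ (n : ℕ) (z : FreeLie R A), IsCommutator R A n z → 0 < n := by
    intro n z hz
    induction hz with
    | of a => exact one_pos
    | lie _ _ h _ => exact Nat.add_pos_left h _
  refine Submodule.span_eq_bot.2 fun z hz => absurd (h 0 z hz) (lt_irrefl 0)

instance : SetLike.GradedBracket (liePower R A) where
  bracket_mem m n x y hx hy := by
    induction hx using Submodule.span_induction with
    | mem x hx =>
      induction hy using Submodule.span_induction with
      | mem y hy => exact Submodule.subset_span (IsCommutator.lie hx hy)
      | zero => simp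
      | add y z _ _ h h' => rw [lie_add]; exact add_mem h h'
      | smul r y _ h => rw [lie_smul]; exact Submodule.smul_mem _ _ h
    | zero => simp
    | add x z _ _ h h' => rw [add_lie]; exact add_mem h h'
    | smul r x _ h => rw [smul_lie]; exact Submodule.smul_mem _ _ h

variable {R A}

theorem map_mem_liePower {B : Type v} [AddCommGroup B] [Module R B] (f : A →ₗ[R] B) (n : ℕ)
    (x : FreeLie R A) (hx : x ∈ liePower R A n) :
    (FreeLie.map f : FreeLie R A →ₗ[R] FreeLie R B) x ∈ liePower R B n := by
  refine (Submodule.span_le.2 ?_ : liePower R A n ≤ (liePower R B n).comap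
    (FreeLie.map f : FreeLie R A →ₗ[R] FreeLie R B)) hx
  intro z hz
  refine Submodule.subset_span ?_
  change IsCommutator R B n (FreeLie.map f z)
  clear hx
  induction hz with
  | of a => rw [FreeLie.map_of]; exact IsCommutator.of _
  | lie _ _ h h' => rw [LieHom.map_lie]; exact IsCommutator.lie h h'

/-- The map `L^n(A) → L^n(B)` induced by a linear map `A → B`. -/
def liePowerMap {B : Type v} [AddCommGroup B] [Module R B] (f : A →ₗ[R] B) (n : ℕ) :
    liePower R A n →ₗ[R] liePower R B n :=
  (FreeLie.map f : FreeLie R A →ₗ[R] FreeLie R B).restrict (map_mem_liePower f n)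

theorem liePowerMap_id (n : ℕ) : liePowerMap (LinearMap.id : A →ₗ[R] A) n = LinearMap.id := by
  ext x
  simp [liePowerMap, FreeLie.map_id]

theorem liePowerMap_comp {B C : Type v} [AddCommGroup B] [Module R B] [AddCommGroup C]
    [Module R C] (g : B →ₗ[R] C) (f : A →ₗ[R] B) (n : ℕ) :
    liePowerMap (g ∘ₗ f) n = liePowerMap g n ∘ₗ liePowerMap f n := by
  ext x
  simp [liePowerMap, FreeLie.map_comp]

/-- The map `C_i^{(n)}(L^*(A)) → C_i^{(n)}(L^*(B))` induced by a linear map `A → B`. -/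
def ceMap {B : Type v} [AddCommGroup B] [Module R B] (f : A →ₗ[R] B) (n i : ℕ) :
    cePart R (liePower R A) n i →ₗ[R] cePart R (liePower R B) n i :=
  (ExteriorAlgebra.map (FreeLie.map f : FreeLie R A →ₗ[R] FreeLie R B)).toLinearMap.restrict
    (map_mem R _ _ _ (map_mem_liePower f) n i)

theorem ceMap_id (n i : ℕ) : ceMap (LinearMap.id : A →ₗ[R] A) n i = LinearMap.id := by
  ext x
  have : ((LieHom.id : FreeLie R A →ₗ⁅R⁆ FreeLie R A) : FreeLie R A →ₗ[R] FreeLie R A) =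
    LinearMap.id := rfl
  simp [ceMap, FreeLie.map_id, this]

theorem ceMap_comp {B C : Type v} [AddCommGroup B] [Module R B] [AddCommGroup C]
    [Module R C] (g : B →ₗ[R] C) (f : A →ₗ[R] B) (n i : ℕ) :
    ceMap (g ∘ₗ f) n i = ceMap g n i ∘ₗ ceMap f n i := by
  ext x
  have : (((FreeLie.map g).comp (FreeLie.map f) : FreeLie R A →ₗ⁅R⁆ FreeLie R C) :
      FreeLie R A →ₗ[R] FreeLie R C) =
    (FreeLie.map g : FreeLie R B →ₗ[R] FreeLie R C) ∘ₗ
      (FreeLie.map f : FreeLie R A →ₗ[R] FreeLie R B) := rfl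
  simp [ceMap, FreeLie.map_comp, ← ExteriorAlgebra.map_comp_map]

variable (R A)

/-- The differential `C_{i+1}^{(n)}(L^*(A)) → C_i^{(n)}(L^*(A))`. -/
def ceD (n i : ℕ) :
    cePart R (liePower R A) n (i + 1) →ₗ[R] cePart R (liePower R A) n i :=
  (d R).restrict (d_mem R (liePower R A) n i)

/-- The ordered `n`-tuples `(k₁, …, kₙ)` of non-negative integers with `∑ kⱼ = i` and
`∑ j kⱼ = n`; the index `j : Fin n` stands for `j + 1`. -/
abbrev Tuples (n i : ℕ) : Type :=
  {k : Fin n → ℕ // ∑ j, k j = i ∧ ∑ j : Fin n, ((j : ℕ) + 1) * k j = n}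

/-- The module `Λ^{k₁} L¹(A) ⊗ … ⊗ Λ^{kₙ} Lⁿ(A)`. -/
abbrev TensorTerm {n : ℕ} (k : Fin n → ℕ) : Type (max u v) :=
  ⨂[R] j : Fin n, ⋀[R]^(k j) (liePower R A (j + 1))

/-- The module `⨁ Λ^{k₁} L¹(A) ⊗ … ⊗ Λ^{kₙ} Lⁿ(A)`, summed over `Tuples n i`. -/
abbrev TermSum (n i : ℕ) : Type (max u v) :=
  ⨁ k : Tuples n i, TensorTerm R A k.1

instance (n i : ℕ) : AddCommGroup (TermSum R A n i) :=
  Module.addCommMonoidToAddCommGroup R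

variable {R A}

/-- The map induced by a linear map `A → B` on the direct sum of the tensor terms. -/
def termMap {B : Type v} [AddCommGroup B] [Module R B] (f : A →ₗ[R] B) (n i : ℕ) :
    TermSum R A n i →ₗ[R] TermSum R B n i :=
  DirectSum.lmap fun k =>
    PiTensorProduct.map fun j => exteriorPower.map (k.1 j) (liePowerMap f (j + 1))

end FreeLie

/-! ### Functors on free modules -/

section Functors

variable (R : Type u) [CommRing R]

/-- The category of free `R`-modules. -/
abbrev FMod : Type (max u (v + 1)) :=
  ObjectProperty.FullSubcategory fun M : ModuleCat.{v} R => Module.Free R M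

/-- The Lie power functor `L^n` from free modules to modules. -/
def liePowerFunctor (n : ℕ) : FMod.{u, v} R ⥤ ModuleCat.{max u v} R where
  obj A := ModuleCat.of R (liePower R A.obj n)
  map f := ModuleCat.ofHom (liePowerMap f.hom.hom n)
  map_id A := by
    ext1
    exact liePowerMap_id n
  map_comp f g := by
    ext1
    exact liePowerMap_comp _ _ n

/-- The functor `⨁ Λ^{k₁} L¹ ⊗ … ⊗ Λ^{kₙ} Lⁿ`, where the sum runs over the tuples with
`∑ kⱼ = i` and `∑ j kⱼ = n`. -/
def termFunctor (n i : ℕ) : FMod.{u, v} R ⥤ ModuleCat.{max u v} R where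
  obj A := ModuleCat.of R (TermSum R A.obj n i)
  map f := ModuleCat.ofHom (termMap f.hom.hom n i)
  map_id A := by
    ext1
    change termMap LinearMap.id n i = LinearMap.id
    simp only [termMap, liePowerMap_id, exteriorPower.map_id, PiTensorProduct.map_id,
      DirectSum.lmap_id]
  map_comp {A B C} f g := by
    ext1
    change termMap (g.hom.hom ∘ₗ f.hom.hom) n i = termMap g.hom.hom n i ∘ₗ termMap f.hom.hom n i
    have h : ∀ (m k : ℕ), exteriorPower.map k (liePowerMap (g.hom.hom ∘ₗ f.hom.hom) m) =
        exteriorPower.map k (liePowerMap g.hom.hom m) ∘ₗ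
          exteriorPower.map k (liePowerMap f.hom.hom m) := fun m k => by
      rw [liePowerMap_comp, exteriorPower.map_comp]
    simp only [termMap, h, PiTensorProduct.map_comp, DirectSum.lmap_comp]

/-- The exterior power functor `Λ^n` from free modules to modules. -/
def extPowerFunctor (n : ℕ) : FMod.{u, v} R ⥤ ModuleCat.{max u v} R :=
  ObjectProperty.ι _ ⋙ ModuleCat.exteriorPower.functor R n

/-- The functor `A ↦ C_i^{(n)}(L^*(A))`. -/
def ceFunctor (n i : ℕ) : FMod.{u, v} R ⥤ ModuleCat.{max u v} R where
  obj A := ModuleCat.of R (cePart R (liePower R A.obj) n i)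
  map f := ModuleCat.ofHom (ceMap f.hom.hom n i)
  map_id A := by
    ext1
    exact ceMap_id n i
  map_comp f g := by
    ext1
    exact ceMap_comp _ _ n i

/-- The differential `C_{i+1}^{(n)} ⟶ C_i^{(n)}` as a morphism of functors. -/
def ceDiff (n i : ℕ) : ceFunctor.{u, v} R n (i + 1) ⟶ ceFunctor R n i where
  app A := ModuleCat.ofHom (ceD R A.obj n i)
  naturality A B f := by
    ext x
    exact Subtype.ext (map_d R (FreeLie.map f.hom.hom) x.1).symm

/-- The complex `C_•^{(n)}` of functors from free modules to modules: the degree `n` part of the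
Chevalley–Eilenberg complex of the free Lie algebra. -/
def ceComplex (n : ℕ) : ChainComplex (FMod.{u, v} R ⥤ ModuleCat.{max u v} R) ℕ :=
  ChainComplex.of (ceFunctor R n) (ceDiff R n) fun i => by
    ext A x
    exact Subtype.ext (d_d R x.1)

end Functors

end GradedCE

end

namespace GradedCE

/-! ### Exterior algebras, contractions and the differential -/

section Contraction

variable {R : Type u} [CommRing R] {𝔤 : Type w} [LieRing 𝔤] [LieAlgebra R 𝔤]

/-! Acyclicity says that a free Lie algebra has no homology in degrees above one, and that its first
homology is carried by the generators, which have weight 1 < n. The proof is by Lazard elimination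
and works over any commutative ring. Give the generators positive weights. Splitting off a generator
`x` of weight `m` writes the free Lie algebra as `𝔤 = 𝔨 ⋊ R x`, where `𝔨` is free on the elements
`(ad x)^i y` with `y ≠ x` (`exists_lineSplitting`). Then `Λ𝔤 = Λ𝔨 ⊕ x ∧ Λ𝔨`, and up to signs the
complex of `𝔤` is the mapping cone of the action `Θ` of `x` on the complex of `𝔨`. So exactness in
degrees at least two passes from `𝔨` to `𝔤` once `Θ` is injective on the first homology of `𝔨`
(`LineSplitting.exactAbove`). It is, because it shifts `(ad x)^i y` to `(ad x)^(i+1) y`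
(`splitting_exact_one`). Eliminating generators of least weight one after another raises all weights
above a given bound, where the relevant pieces vanish (`exactAbove_weightPart_aux`). Restriction to
finitely many generators and the choice of a basis of `A` give the case of `L^*(A)`
(`exactAbove_liePower`). In degree one, a commutator of length at least two is a boundary. For the
decomposition, coefficient extraction in `R[X] ⊗ L^*(A)` shows that the Lie powers are independent
(`exists_liePowerProj`). Multiplication from the tensor product of the `Λ(L^j)` has a left inverse,
obtained by letting `Λ L^*(A)` act on that tensor product with Koszul signs and evaluating at `1 ⊗ …
⊗ 1` (`extAction_extMul`). Surjectivity onto a graded piece follows by multiplying by homogeneous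
vectors one at a time. -/

/-- Contraction of an exterior algebra with a linear form. -/
noncomputable def contract {M : Type w} [AddCommGroup M] [Module R M] (φ : M →ₗ[R] R) :
    ExteriorAlgebra R M →ₗ[R] ExteriorAlgebra R M :=
  CliffordAlgebra.contractLeft (Q := (0 : QuadraticForm R M)) φ

theorem contract_one {M : Type w} [AddCommGroup M] [Module R M] (φ : M →ₗ[R] R) :
    contract φ (1 : ExteriorAlgebra R M) = 0 :=
  CliffordAlgebra.contractLeft_one _ _

theorem contract_ι_mul {M : Type w} [AddCommGroup M] [Module R M] (φ : M →ₗ[R] R) (x : M)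
    (ω : ExteriorAlgebra R M) :
    contract φ (ExteriorAlgebra.ι R x * ω) = φ x • ω - ExteriorAlgebra.ι R x * contract φ ω :=
  CliffordAlgebra.contractLeft_ι_mul (Q := (0 : QuadraticForm R M)) _ _ _

theorem ι_mul_ι_mul {M : Type w} [AddCommGroup M] [Module R M] (x y : M)
    (ω : ExteriorAlgebra R M) :
    ExteriorAlgebra.ι R x * (ExteriorAlgebra.ι R y * ω) =
      -(ExteriorAlgebra.ι R y * (ExteriorAlgebra.ι R x * ω)) := by
  rw [← mul_assoc, ← mul_assoc, eq_neg_of_add_eq_zero_left (ExteriorAlgebra.ι_add_mul_swap x y),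
    neg_mul]

theorem contract_map_eq_zero {M N : Type w} [AddCommGroup M] [Module R M] [AddCommGroup N]
    [Module R N] (φ : N →ₗ[R] R) (f : M →ₗ[R] N) (h : ∀ x, φ (f x) = 0)
    (ω : ExteriorAlgebra R M) : contract φ (ExteriorAlgebra.map f ω) = 0 := by
  induction ω using ext_induction with
  | one => rw [map_one, contract_one]
  | add a b ha hb => simp only [map_add, ha, hb, add_zero]
  | smul r a ha => simp only [map_smul, ha, smul_zero]
  | mul x a ha =>
    simp only [map_mul, ExteriorAlgebra.map_apply_ι, contract_ι_mul, h, ha, zero_smul, mul_zero,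
      sub_zero]

theorem algebraMapInv_ι_mul {M : Type w} [AddCommGroup M] [Module R M] (x : M)
    (ω : ExteriorAlgebra R M) :
    ExteriorAlgebra.algebraMapInv (ExteriorAlgebra.ι R x * ω) = 0 := by
  simp [ExteriorAlgebra.algebraMapInv]

theorem algebraMapInv_adExt (x : 𝔤) (ω : ExteriorAlgebra R 𝔤) :
    ExteriorAlgebra.algebraMapInv (adExt R x ω) = 0 := by
  induction ω using ext_induction with
  | one => simp
  | add a b ha hb => simp only [map_add, ha, hb, add_zero]
  | smul r a ha => simp only [map_smul, ha, smul_zero]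
  | mul y a ha => simp only [adExt_ι_mul, map_add, algebraMapInv_ι_mul, add_zero]

theorem algebraMapInv_d (ω : ExteriorAlgebra R 𝔤) :
    ExteriorAlgebra.algebraMapInv (d R ω) = 0 := by
  induction ω using ext_induction with
  | one => simp [d_one]
  | add a b ha hb => simp only [map_add, ha, hb, add_zero]
  | smul r a ha => simp only [map_smul, ha, smul_zero]
  | mul y a ha =>
    simp only [d_ι_mul, map_sub, map_neg, algebraMapInv_ι_mul, algebraMapInv_adExt, sub_zero,
      neg_zero]

/-- A linear form that vanishes on brackets vanishes on the boundaries in degree one. -/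
theorem algebraMapInv_contract_d (φ : 𝔤 →ₗ[R] R) (hφ : ∀ x y : 𝔤, φ ⁅x, y⁆ = 0)
    (ω : ExteriorAlgebra R 𝔤) : ExteriorAlgebra.algebraMapInv (contract φ (d R ω)) = 0 := by
  have had : ∀ (x : 𝔤) (ω : ExteriorAlgebra R 𝔤),
      ExteriorAlgebra.algebraMapInv (contract φ (adExt R x ω)) = 0 := by
    intro x ω
    induction ω using ext_induction with
    | one => simp
    | add a b ha hb => simp only [map_add, ha, hb, add_zero]
    | smul r a ha => simp only [map_smul, ha, smul_zero]
    | mul y a ha =>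
      simp only [adExt_ι_mul, map_add, contract_ι_mul, hφ, map_sub, map_smul, algebraMapInv_ι_mul,
        algebraMapInv_adExt, smul_zero, zero_smul, sub_zero, add_zero, map_zero]
  induction ω using ext_induction with
  | one => simp [d_one]
  | add a b ha hb => simp only [map_add, ha, hb, add_zero]
  | smul r a ha => simp only [map_smul, ha, smul_zero]
  | mul y a ha =>
    simp only [d_ι_mul, map_sub, map_neg, contract_ι_mul, had, map_smul, algebraMapInv_ι_mul,
      algebraMapInv_d, smul_zero, sub_zero, neg_zero]

/-- Contraction followed by the augmentation reads `φ z` off `ι z` and kills boundaries. In other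
words, `φ` descends to the first homology `𝔤 / [𝔤, 𝔤]`. -/
theorem apply_eq_zero_of_ι_eq_d (φ : 𝔤 →ₗ[R] R) (hφ : ∀ x y : 𝔤, φ ⁅x, y⁆ = 0) (z : 𝔤)
    (ω : ExteriorAlgebra R 𝔤) (h : ExteriorAlgebra.ι R z = d R ω) : φ z = 0 := by
  have h' := algebraMapInv_contract_d φ hφ ω
  rw [← h, ← mul_one (ExteriorAlgebra.ι R z), contract_ι_mul, contract_one] at h'
  simpa using h'

theorem d_ι (x : 𝔤) : d R (ExteriorAlgebra.ι R x) = 0 := by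
  rw [← mul_one (ExteriorAlgebra.ι R x), d_ι_mul, d_one, adExt_one]
  simp

theorem adExt_ι (x y : 𝔤) : adExt R x (ExteriorAlgebra.ι R y) = ExteriorAlgebra.ι R ⁅x, y⁆ := by
  rw [← mul_one (ExteriorAlgebra.ι R y), adExt_ι_mul, adExt_one]
  simp

theorem d_ι_mul_ι (x y : 𝔤) :
    d R (ExteriorAlgebra.ι R x * ExteriorAlgebra.ι R y) = -ExteriorAlgebra.ι R ⁅x, y⁆ := by
  rw [d_ι_mul, d_ι, adExt_ι]
  simp

end Contraction

/-! ### Graded pieces: induction, contraction, vanishing and degree one -/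

section CePart

variable {R : Type u} [CommRing R] {𝔤 : Type w} [LieRing 𝔤] [LieAlgebra R 𝔤]
  {𝒢 : ℕ → Submodule R 𝔤}

theorem one_mem_cePart : (1 : ExteriorAlgebra R 𝔤) ∈ cePart R 𝒢 0 0 :=
  Submodule.subset_span ⟨Fin.elim0, Fin.elim0, fun k => k.elim0, rfl,
    ExteriorAlgebra.ιMulti_zero_apply _⟩

theorem ι_mul_mem_cePart {a n i : ℕ} {z : 𝔤} (hz : z ∈ 𝒢 a) {ω : ExteriorAlgebra R 𝔤}
    (hω : ω ∈ cePart R 𝒢 n i) : ExteriorAlgebra.ι R z * ω ∈ cePart R 𝒢 (a + n) (i + 1) := by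
  refine (Submodule.span_le.2 ?_ : cePart R 𝒢 n i ≤
    (cePart R 𝒢 (a + n) (i + 1)).comap (LinearMap.mulLeft R (ExteriorAlgebra.ι R z))) hω
  rintro _ ⟨x, deg, hx, hdeg, rfl⟩
  refine Submodule.subset_span ⟨Fin.cons z x, Fin.cons a deg, ?_, ?_, ?_⟩
  · intro k
    refine Fin.cases ?_ (fun k => ?_) k
    · exact hz
    · exact hx k
  · rw [Fin.sum_univ_succ]
    simp [hdeg]
  · rw [ιMulti_succ]
    simp

/-- Induction on the graded pieces of the complex: multiply by homogeneous vectors. -/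
theorem cePart_le_of_ι_mul (P : ℕ → ℕ → Submodule R (ExteriorAlgebra R 𝔤)) (one : 1 ∈ P 0 0)
    (mul : ∀ (a n i : ℕ) (z : 𝔤), z ∈ 𝒢 a → ∀ ω ∈ cePart R 𝒢 n i, ω ∈ P n i →
      ExteriorAlgebra.ι R z * ω ∈ P (a + n) (i + 1)) (n i : ℕ) : cePart R 𝒢 n i ≤ P n i := by
  refine Submodule.span_le.2 ?_
  rintro _ ⟨x, deg, hx, rfl, rfl⟩
  change _ ∈ P _ _
  induction i with
  | zero => simpa [ExteriorAlgebra.ιMulti_zero_apply] using one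
  | succ i ih =>
    rw [ιMulti_succ, Fin.sum_univ_succ]
    exact mul _ _ _ _ (hx 0) _
      (Submodule.subset_span ⟨_, _, fun k => hx k.succ, rfl, rfl⟩)
      (ih (fun k => x k.succ) (fun k => deg k.succ) fun k => hx k.succ)

theorem adExt_mem_cePart [SetLike.GradedBracket 𝒢] {m : ℕ} {x : 𝔤} (hx : x ∈ 𝒢 m) (n i : ℕ)
    {ω : ExteriorAlgebra R 𝔤} (hω : ω ∈ cePart R 𝒢 n i) :
    adExt R x ω ∈ cePart R 𝒢 (n + m) i := by
  refine cePart_le_of_ι_mul (fun n i => (cePart R 𝒢 (n + m) i).comap (adExt R x)) ?_ ?_ n i hω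
  · simp
  · intro a n i z hz ω hω hω'
    change adExt R x _ ∈ cePart R 𝒢 (a + n + m) (i + 1)
    rw [adExt_ι_mul]
    refine add_mem ?_ ?_
    · have := ι_mul_mem_cePart (SetLike.GradedBracket.bracket_mem (ℒ := 𝒢) hx hz) hω
      rwa [show m + a + n = a + n + m by ring] at this
    · have := ι_mul_mem_cePart hz hω'
      rwa [← add_assoc] at this

/-- Contraction with a linear form of degree `-m`. -/
theorem contract_mem_cePart {m : ℕ} (φ : 𝔤 →ₗ[R] R) (hφ : ∀ a, a ≠ m → ∀ z ∈ 𝒢 a, φ z = 0)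
    (n i : ℕ) {ω : ExteriorAlgebra R 𝔤} (hω : ω ∈ cePart R 𝒢 (n + m) (i + 1)) :
    contract φ ω ∈ cePart R 𝒢 n i := by
  -- The induction needs a target in every bidegree, but contraction lowers weight by `m` and degree
  -- by 1. The supremum encodes this shift without subtraction: it is zero when no shifted bidegree
  -- exists.
  let B : ℕ → ℕ → Submodule R (ExteriorAlgebra R 𝔤) := fun n i =>
    ⨆ p : {p : ℕ × ℕ // p.1 + m = n ∧ p.2 + 1 = i}, cePart R 𝒢 p.1.1 p.1.2
  have hB : ∀ n i ω, ω ∈ cePart R 𝒢 n i → ω ∈ B (n + m) (i + 1) := fun n i ω h =>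
    Submodule.mem_iSup_of_mem (p := fun p : {p : ℕ × ℕ // p.1 + m = n + m ∧ p.2 + 1 = i + 1} =>
      cePart R 𝒢 p.1.1 p.1.2) ⟨(n, i), rfl, rfl⟩ h
  have hB' : B (n + m) (i + 1) ≤ cePart R 𝒢 n i := by
    refine iSup_le ?_
    rintro ⟨⟨n', i'⟩, h1, h2⟩
    obtain rfl : n' = n := by simpa using h1
    obtain rfl : i' = i := by simpa using h2
    exact le_rfl
  refine hB' (cePart_le_of_ι_mul (fun n i => (B n i).comap (contract φ)) ?_ ?_ _ _ hω)
  · simp [contract_one]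
  · intro a n i z hz σ hσ hσ'
    change contract φ _ ∈ B (a + n) (i + 1)
    rw [contract_ι_mul]
    refine sub_mem ?_ ?_
    · by_cases ha : a = m
      · subst ha
        rw [add_comm a n]
        exact Submodule.smul_mem _ _ (hB _ _ _ hσ)
      · rw [hφ a ha z hz, zero_smul]
        exact zero_mem _
    · refine (iSup_le ?_ : B n i ≤
        (B (a + n) (i + 1)).comap (LinearMap.mulLeft R (ExteriorAlgebra.ι R z))) hσ'
      rintro ⟨⟨n', i'⟩, h1, h2⟩ η hη
      obtain rfl : n' + m = n := h1
      obtain rfl : i' + 1 = i := h2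
      rw [← add_assoc]
      exact hB _ _ _ (ι_mul_mem_cePart hz hη)

/-- If `i` weights add up to less than `m * i`, one of them is below `m`, and the corresponding
factor of the wedge is zero. -/
theorem cePart_eq_bot (m : ℕ) (h : ∀ a < m, 𝒢 a = ⊥) {n i : ℕ} (hn : n < m * i) :
    cePart R 𝒢 n i = ⊥ := by
  refine Submodule.span_eq_bot.2 ?_
  rintro _ ⟨x, deg, hx, rfl, rfl⟩
  obtain ⟨k, hk⟩ : ∃ k, deg k < m := by
    by_contra! hcon
    refine hn.not_ge ?_
    calc m * i = ∑ _k : Fin i, m := by simp [mul_comm]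
      _ ≤ _ := Finset.sum_le_sum fun k _ => hcon k
  have := hx k
  rw [h _ hk, Submodule.mem_bot] at this
  exact AlternatingMap.map_coord_zero _ k this

theorem mem_cePart_one {n : ℕ} {ω : ExteriorAlgebra R 𝔤} (hω : ω ∈ cePart R 𝒢 n 1) :
    ∃ z ∈ 𝒢 n, ExteriorAlgebra.ι R z = ω := by
  refine (Submodule.span_le.2 ?_ : cePart R 𝒢 n 1 ≤ (𝒢 n).map (ExteriorAlgebra.ι R)) hω
  rintro _ ⟨x, deg, hx, rfl, rfl⟩
  refine ⟨x 0, ?_, ?_⟩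
  · simpa using hx 0
  · simp [ExteriorAlgebra.ιMulti_apply]

theorem ι_mem_cePart {n : ℕ} {z : 𝔤} (hz : z ∈ 𝒢 n) :
    ExteriorAlgebra.ι R z ∈ cePart R 𝒢 n 1 := by
  simpa using ι_mul_mem_cePart hz one_mem_cePart

end CePart

/-! ### Splitting off one generator -/

section Elimination

variable {R : Type u} [CommRing R] {𝔨 𝔤 : Type w} [LieRing 𝔨] [LieAlgebra R 𝔨]
  [LieRing 𝔤] [LieAlgebra R 𝔤]

/-- Exactness of the weight `n` part of the complex in all degrees `≥ 2`. -/
def ExactAbove (𝒢 : ℕ → Submodule R 𝔤) (n : ℕ) : Prop :=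
  ∀ i, ∀ ω ∈ cePart R 𝒢 n (i + 2), d R ω = 0 → ∃ η ∈ cePart R 𝒢 n (i + 3), d R η = ω

/-- A presentation of a graded Lie algebra `𝔤` as a semidirect product of an ideal `𝔨` and the
line spanned by an element `x` of degree `m`. -/
structure LineSplitting (𝒦 : ℕ → Submodule R 𝔨) (𝒢 : ℕ → Submodule R 𝔤) (m : ℕ) where
  /-- the inclusion of the ideal -/
  κ : 𝔨 →ₗ⁅R⁆ 𝔤
  /-- the projection to the ideal -/
  π : 𝔤 →ₗ[R] 𝔨
  /-- the coordinate on the line -/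
  φ : 𝔤 →ₗ[R] R
  /-- the generator of the line -/
  x : 𝔤
  /-- the action of the generator on the ideal -/
  θ : 𝔨 →ₗ[R] 𝔨
  π_κ : ∀ k, π (κ k) = k
  φ_κ : ∀ k, φ (κ k) = 0
  π_x : π x = 0
  φ_x : φ x = 1
  decomp : ∀ z, κ (π z) + φ z • x = z
  κ_θ : ∀ k, κ (θ k) = ⁅x, κ k⁆
  κ_mem : ∀ n, ∀ k ∈ 𝒦 n, κ k ∈ 𝒢 n
  π_mem : ∀ n, ∀ z ∈ 𝒢 n, π z ∈ 𝒦 n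
  φ_eq_zero : ∀ a, a ≠ m → ∀ z ∈ 𝒢 a, φ z = 0
  x_mem : x ∈ 𝒢 m

namespace LineSplitting

variable {𝒦 : ℕ → Submodule R 𝔨} {𝒢 : ℕ → Submodule R 𝔤} {m : ℕ} (S : LineSplitting 𝒦 𝒢 m)

/-- The inclusion `Λ 𝔨 → Λ 𝔤`. -/
noncomputable def κΛ : ExteriorAlgebra R 𝔨 →ₐ[R] ExteriorAlgebra R 𝔤 :=
  ExteriorAlgebra.map (S.κ : 𝔨 →ₗ[R] 𝔤)

/-- The projection `Λ 𝔤 → Λ 𝔨`. -/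
noncomputable def πΛ : ExteriorAlgebra R 𝔤 →ₐ[R] ExteriorAlgebra R 𝔨 :=
  ExteriorAlgebra.map S.π

theorem κΛ_ι (k : 𝔨) : S.κΛ (ExteriorAlgebra.ι R k) = ExteriorAlgebra.ι R (S.κ k) :=
  ExteriorAlgebra.map_apply_ι _ _

theorem πΛ_ι (z : 𝔤) : S.πΛ (ExteriorAlgebra.ι R z) = ExteriorAlgebra.ι R (S.π z) :=
  ExteriorAlgebra.map_apply_ι _ _

theorem πΛ_κΛ (ω : ExteriorAlgebra R 𝔨) : S.πΛ (S.κΛ ω) = ω := by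
  induction ω using ext_induction with
  | one => simp
  | add a b ha hb => simp only [map_add, ha, hb]
  | smul r a ha => simp only [map_smul, ha]
  | mul z a ha => rw [map_mul, map_mul, ha, κΛ_ι, πΛ_ι, S.π_κ]

theorem κΛ_injective : Function.Injective S.κΛ :=
  Function.LeftInverse.injective S.πΛ_κΛ

theorem κΛ_d (ω : ExteriorAlgebra R 𝔨) : S.κΛ (d R ω) = d R (S.κΛ ω) :=
  map_d R S.κ ω

/-- The action of the generator on `Λ 𝔨`. -/
noncomputable def Θ : ExteriorAlgebra R 𝔨 →ₗ[R] ExteriorAlgebra R 𝔨 :=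
  S.πΛ.toLinearMap ∘ₗ adExt R S.x ∘ₗ S.κΛ.toLinearMap

/-- Bracketing with `x` preserves the image of `𝔨`, so the projection in the definition of `Θ` loses
nothing. Identities for `Θ` can therefore be checked in `Λ𝔤`. -/
theorem κΛ_Θ (ω : ExteriorAlgebra R 𝔨) : S.κΛ (S.Θ ω) = adExt R S.x (S.κΛ ω) := by
  change S.κΛ (S.πΛ (adExt R S.x (S.κΛ ω))) = _
  induction ω using ext_induction with
  | one => simp
  | add a b ha hb => simp only [map_add, ha, hb]
  | smul r a ha => simp only [map_smul, ha]
  | mul z a ha =>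
    simp only [map_mul, adExt_ι_mul, map_add, ha, κΛ_ι, ← S.κ_θ, πΛ_ι, S.π_κ, πΛ_κΛ]

theorem Θ_d (ω : ExteriorAlgebra R 𝔨) : S.Θ (d R ω) = d R (S.Θ ω) := by
  apply S.κΛ_injective
  rw [κΛ_Θ, κΛ_d, κΛ_d, κΛ_Θ, adExt_d]

theorem Θ_ι (k : 𝔨) : S.Θ (ExteriorAlgebra.ι R k) = ExteriorAlgebra.ι R (S.θ k) := by
  apply S.κΛ_injective
  rw [κΛ_Θ, κΛ_ι, adExt_ι, κΛ_ι, κ_θ]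

theorem κΛ_mem {n i : ℕ} {ω : ExteriorAlgebra R 𝔨} (hω : ω ∈ cePart R 𝒦 n i) :
    S.κΛ ω ∈ cePart R 𝒢 n i :=
  map_mem R 𝒦 𝒢 (S.κ : 𝔨 →ₗ[R] 𝔤) S.κ_mem n i ω hω

theorem πΛ_mem {n i : ℕ} {ω : ExteriorAlgebra R 𝔤} (hω : ω ∈ cePart R 𝒢 n i) :
    S.πΛ ω ∈ cePart R 𝒦 n i :=
  map_mem R 𝒢 𝒦 S.π S.π_mem n i ω hω

theorem Θ_mem [SetLike.GradedBracket 𝒢] {n i : ℕ} {ω : ExteriorAlgebra R 𝔨}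
    (hω : ω ∈ cePart R 𝒦 n i) : S.Θ ω ∈ cePart R 𝒦 (n + m) i :=
  S.πΛ_mem (adExt_mem_cePart S.x_mem n i (S.κΛ_mem hω))

/-- The existence half of `Λ𝔤 = Λ𝔨 ⊕ x ∧ Λ𝔨`: projection gives the first coordinate, and contraction
with the coordinate form of the line gives the second. The induction rests on `z = κ (π z) + φ z •
x` and `x ∧ x = 0`. -/
theorem κΛ_add (ω : ExteriorAlgebra R 𝔤) :
    S.κΛ (S.πΛ ω) + ExteriorAlgebra.ι R S.x * S.κΛ (S.πΛ (contract S.φ ω)) = ω := by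
  induction ω using ext_induction with
  | one => simp [contract_one]
  | add a b ha hb =>
    conv_rhs => rw [← ha, ← hb]
    simp only [map_add, mul_add]
    abel
  | smul r a ha =>
    conv_rhs => rw [← ha]
    simp only [map_smul, smul_add, mul_smul_comm]
  | mul z a ha =>
    conv_rhs => rw [← ha, ← S.decomp z]
    have hx : ExteriorAlgebra.ι R S.x * (ExteriorAlgebra.ι R S.x *
        S.κΛ (S.πΛ (contract S.φ a))) = 0 := by
      rw [← mul_assoc, ExteriorAlgebra.ι_sq_zero, zero_mul]
    simp only [map_mul, contract_ι_mul, map_add, map_sub, map_smul, πΛ_ι, κΛ_ι, mul_add, add_mul,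
      mul_sub, smul_mul_assoc, mul_smul_comm, hx, smul_zero, add_zero,
      ι_mul_ι_mul S.x (S.κ (S.π z))]
    abel

/-- The uniqueness half: the projection kills `x`, and contraction with `φ` kills `Λ𝔨` and removes
the factor `x`. -/
theorem eq_zero_of_κΛ_add {α β : ExteriorAlgebra R 𝔨}
    (h : S.κΛ α + ExteriorAlgebra.ι R S.x * S.κΛ β = 0) : α = 0 ∧ β = 0 := by
  constructor
  · have := congrArg S.πΛ h
    simpa [πΛ_ι, S.π_x, πΛ_κΛ] using this
  · have h0 : ∀ ω, contract S.φ (S.κΛ ω) = 0 :=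
      contract_map_eq_zero S.φ (S.κ : 𝔨 →ₗ[R] 𝔤) S.φ_κ
    have := congrArg (contract S.φ) h
    rw [map_add, h0, contract_ι_mul, h0, S.φ_x] at this
    apply S.κΛ_injective
    simpa using this

/-- Exactness for `𝔨` implies exactness for `𝔤`. -/
theorem exactAbove [SetLike.GradedBracket 𝒢] [SetLike.GradedBracket 𝒦] {n : ℕ}
    (h : ExactAbove 𝒦 (n + m)) (h' : ExactAbove 𝒦 n)
    (h₁ : ∀ b ∈ 𝒦 n, (∃ α, ExteriorAlgebra.ι R (S.θ b) = d R α) →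
      ∃ η ∈ cePart R 𝒦 n 2, d R η = ExteriorAlgebra.ι R b) :
    ExactAbove 𝒢 (n + m) := by
  intro i ω hω hd
  set α := S.πΛ ω with hα_def
  set β := S.πΛ (contract S.φ ω) with hβ_def
  have hα : α ∈ cePart R 𝒦 (n + m) (i + 2) := S.πΛ_mem hω
  have hβ : β ∈ cePart R 𝒦 n (i + 1) :=
    S.πΛ_mem (contract_mem_cePart S.φ S.φ_eq_zero n (i + 1) hω)
  have hωαβ : S.κΛ α + ExteriorAlgebra.ι R S.x * S.κΛ β = ω := S.κΛ_add ω
  -- The cone formula `d (α + x ∧ β) = (d α - Θ β) - x ∧ d β`: a cycle amounts to `d α = Θ β` and `d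
  -- β = 0`.
  obtain ⟨hdα, hdβ⟩ := S.eq_zero_of_κΛ_add (α := d R α - S.Θ β) (β := -d R β) (by
    rw [← hd, ← hωαβ, map_add, d_ι_mul, map_sub, κΛ_d, κΛ_Θ, map_neg, κΛ_d]
    simp only [mul_neg]
    abel)
  rw [sub_eq_zero] at hdα
  rw [neg_eq_zero] at hdβ
  -- In degree one exactness of `𝔨` says nothing about `β`. There `Θ β` is the boundary of `α`,
  -- which is what `h₁` requires.
  obtain ⟨η, hη, hdη⟩ : ∃ η ∈ cePart R 𝒦 n (i + 2), d R η = β := by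
    cases i with
    | zero =>
      obtain ⟨b, hb, hbβ⟩ := mem_cePart_one hβ
      rw [← hbβ]
      refine h₁ b hb ⟨α, ?_⟩
      rw [hdα, ← hbβ, Θ_ι]
    | succ i => exact h' i β hβ hdβ
  -- Since `d (x ∧ η) = -(x ∧ β) - Θ η`, the element `ζ - x ∧ η` bounds `ω` as soon as `d ζ = α - Θ
  -- η`.
  obtain ⟨ζ, hζ, hdζ⟩ := h i (α - S.Θ η) (sub_mem hα (S.Θ_mem hη)) (by
    rw [map_sub, ← Θ_d, hdη, hdα, sub_self])
  refine ⟨S.κΛ ζ - ExteriorAlgebra.ι R S.x * S.κΛ η, sub_mem (S.κΛ_mem hζ) ?_, ?_⟩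
  · rw [add_comm n m]
    exact ι_mul_mem_cePart S.x_mem (S.κΛ_mem hη)
  · rw [map_sub, d_ι_mul, ← κΛ_d, ← κΛ_d, ← κΛ_Θ, hdη, hdζ, ← hωαβ, map_sub]
    abel

end LineSplitting

end Elimination

/-! ### Free Lie algebras on weighted sets -/

section FreeWeighted

variable (R : Type u) [CommRing R] {X : Type v} (w : X → ℕ)

/-- The free Lie algebra on a set, with the module structure that comes from its structure of a
Lie algebra. -/
def FreeLieOn (X : Type v) : Type (max u v) := FreeLieAlgebra R X

namespace FreeLieOn

noncomputable instance : LieRing (FreeLieOn R X) := inferInstanceAs (LieRing (FreeLieAlgebra R X))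

noncomputable instance : LieAlgebra R (FreeLieOn R X) :=
  inferInstanceAs (LieAlgebra R (FreeLieAlgebra R X))

/-- The generators. -/
noncomputable def of (x : X) : FreeLieOn R X := FreeLieAlgebra.of R x

/-- The universal property. -/
noncomputable def lift {𝔤 : Type w'} [LieRing 𝔤] [LieAlgebra R 𝔤] (f : X → 𝔤) :
    FreeLieOn R X →ₗ⁅R⁆ 𝔤 := FreeLieAlgebra.lift R f

variable {R}

@[simp]
theorem lift_of_apply {𝔤 : Type w'} [LieRing 𝔤] [LieAlgebra R 𝔤] (f : X → 𝔤) (x : X) :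
    lift R f (of R x) = f x :=
  FreeLieAlgebra.lift_of_apply f x

@[ext]
theorem hom_ext {𝔤 : Type w'} [LieRing 𝔤] [LieAlgebra R 𝔤] {F G : FreeLieOn R X →ₗ⁅R⁆ 𝔤}
    (h : ∀ x, F (of R x) = G (of R x)) : F = G :=
  FreeLieAlgebra.hom_ext h

end FreeLieOn

/-- Iterated commutators of generators, with the total weight of the generators. -/
inductive IsWeightedCommutator : ℕ → FreeLieOn R X → Prop
  | of (x : X) : IsWeightedCommutator (w x) (FreeLieOn.of R x)
  | lie {m n : ℕ} {x y : FreeLieOn R X} :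
      IsWeightedCommutator m x → IsWeightedCommutator n y → IsWeightedCommutator (m + n) ⁅x, y⁆

/-- The span of the commutators of weight `n`. -/
noncomputable def weightPart (n : ℕ) : Submodule R (FreeLieOn R X) :=
  Submodule.span R {z | IsWeightedCommutator R w n z}

instance : SetLike.GradedBracket (weightPart R w) where
  bracket_mem m n x y hx hy := by
    induction hx using Submodule.span_induction with
    | mem x hx =>
      induction hy using Submodule.span_induction with
      | mem y hy => exact Submodule.subset_span (IsWeightedCommutator.lie hx hy)
      | zero => simp
      | add y z _ _ h h' => rw [lie_add]; exact add_mem h h'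
      | smul r y _ h => rw [lie_smul]; exact Submodule.smul_mem _ _ h
    | zero => simp
    | add x z _ _ h h' => rw [add_lie]; exact add_mem h h'
    | smul r x _ h => rw [smul_lie]; exact Submodule.smul_mem _ _ h

variable {R w}

theorem of_mem_weightPart (x : X) : FreeLieOn.of R x ∈ weightPart R w (w x) :=
  Submodule.subset_span (IsWeightedCommutator.of x)

theorem weightPart_induction (P : ℕ → Submodule R (FreeLieOn R X))
    (of : ∀ x, FreeLieOn.of R x ∈ P (w x))
    (lie : ∀ m n, ∀ x ∈ weightPart R w m, ∀ y ∈ weightPart R w n, x ∈ P m → y ∈ P n →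
      ⁅x, y⁆ ∈ P (m + n)) (n : ℕ) : weightPart R w n ≤ P n := by
  refine Submodule.span_le.2 fun z hz => ?_
  change z ∈ P n
  induction hz with
  | of x => exact of x
  | lie hx hy h h' =>
    exact lie _ _ _ (Submodule.subset_span hx) _ (Submodule.subset_span hy) h h'

theorem lift_mem {𝔤 : Type w'} [LieRing 𝔤] [LieAlgebra R 𝔤] (𝒢 : ℕ → Submodule R 𝔤)
    [SetLike.GradedBracket 𝒢] (f : X → 𝔤) (hf : ∀ x, f x ∈ 𝒢 (w x)) (n : ℕ)
    (z : FreeLieOn R X) (hz : z ∈ weightPart R w n) : FreeLieOn.lift R f z ∈ 𝒢 n := by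
  refine weightPart_induction (w := w)
    (fun n => (𝒢 n).comap (FreeLieOn.lift R f : FreeLieOn R X →ₗ[R] 𝔤)) ?_ ?_ n hz
  · intro x
    simpa using hf x
  · intro m n x _ y _ hx hy
    simpa using SetLike.GradedBracket.bracket_mem (ℒ := 𝒢) hx hy

theorem weightPart_eq_bot (m : ℕ) (h : ∀ x, m ≤ w x) {n : ℕ} (hn : n < m) :
    weightPart R w n = ⊥ := by
  refine Submodule.span_eq_bot.2 fun z hz => absurd hn (not_lt.2 ?_)
  change IsWeightedCommutator R w n z at hz
  induction hz with
  | of x => exact h x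
  | lie _ _ h _ => omega

@[elab_as_elim]
-- The elements with property `P` form a Lie subalgebra containing the generators. The homomorphism
-- to it given by the universal property, followed by the inclusion, is the identity.
theorem freeLieOn_induction {P : FreeLieOn R X → Prop} (zero : P 0)
    (add : ∀ x y, P x → P y → P (x + y)) (smul : ∀ (r : R) x, P x → P (r • x))
    (of : ∀ x, P (FreeLieOn.of R x)) (lie : ∀ x y, P x → P y → P ⁅x, y⁆)
    (z : FreeLieOn R X) : P z := by
  let Q : LieSubalgebra R (FreeLieOn R X) :=
    { carrier := {z | P z}
      add_mem' := add _ _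
      zero_mem' := zero
      smul_mem' := smul
      lie_mem' := lie _ _ }
  have h : Q.incl.comp (FreeLieOn.lift R fun x => (⟨FreeLieOn.of R x, of x⟩ : Q)) =
      LieHom.id := by
    ext x
    simp
  have h' := LieHom.congr_fun h z
  rw [LieHom.id_apply] at h'
  rw [← h']
  exact (FreeLieOn.lift R (fun x => (⟨FreeLieOn.of R x, of x⟩ : Q)) z).2

/-- Derivations can be prescribed on generators `j x`, provided that homomorphisms can. -/
theorem exists_derivation_of_lift {𝔤 : Type w'} [LieRing 𝔤] [LieAlgebra R 𝔤] {S : Type u} [CommRing S] [Algebra R S] (χ : S →ₐ[R] R)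
    (δ : S →ₗ[R] R) (hδ : ∀ s t, δ (s * t) = χ s * δ t + χ t * δ s) (ε : S) (hχε : χ ε = 0)
    (hδε : δ ε = 1) (hδ₁ : δ 1 = 0) (j : X → 𝔤)
    (hlift : ∀ h : X → S ⊗[R] 𝔤, ∃ F : 𝔤 →ₗ⁅R⁆ S ⊗[R] 𝔤, ∀ x, F (j x) = h x)
    (huniq : ∀ G : 𝔤 →ₗ⁅R⁆ 𝔤, (∀ x, G (j x) = j x) → G = LieHom.id) (f : X → 𝔤) :
    ∃ D : LieDerivation R (𝔤) (𝔤),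
      ∀ x, D (j x) = f x := by
  -- The model for `S` is the dual numbers, with `χ` the augmentation and `δ` the coefficient of
  -- `ε`. A homomorphism `z ↦ z + ε D z` has a derivation `D` as its `ε`-part. Here `p` takes the
  -- constant part and `q` the `ε`-part.
  let p : S ⊗[R] 𝔤 →ₗ[R] 𝔤 :=
    (TensorProduct.lid R (𝔤)).toLinearMap ∘ₗ LinearMap.rTensor _ χ.toLinearMap
  let q : S ⊗[R] 𝔤 →ₗ[R] 𝔤 :=
    (TensorProduct.lid R (𝔤)).toLinearMap ∘ₗ LinearMap.rTensor _ δ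
  have hp : ∀ s x, p (s ⊗ₜ x) = χ s • x := fun s x => rfl
  have hq : ∀ s x, q (s ⊗ₜ x) = δ s • x := fun s x => rfl
  have hpl : ∀ a b : S ⊗[R] 𝔤, p ⁅a, b⁆ = ⁅p a, p b⁆ := by
    intro a b
    induction a using TensorProduct.induction_on with
    | zero => simp
    | add a a' h h' => rw [add_lie, map_add, map_add, h, h', add_lie]
    | tmul s x =>
      induction b using TensorProduct.induction_on with
      | zero => simp
      | add b b' h h' => rw [lie_add, map_add, map_add, h, h', lie_add]
      | tmul t y =>
        rw [LieAlgebra.ExtendScalars.bracket_tmul, hp, hp, hp, map_mul, smul_lie,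
          lie_smul, smul_smul]
  have hql : ∀ a b : S ⊗[R] 𝔤, q ⁅a, b⁆ = ⁅p a, q b⁆ - ⁅p b, q a⁆ := by
    intro a b
    induction a using TensorProduct.induction_on with
    | zero => simp
    | add a a' h h' =>
      simp only [add_lie, map_add, h, h', lie_add]
      abel
    | tmul s x =>
      induction b using TensorProduct.induction_on with
      | zero => simp
      | add b b' h h' =>
        simp only [add_lie, map_add, h, h', lie_add]
        abel
      | tmul t y =>
        rw [LieAlgebra.ExtendScalars.bracket_tmul, hp, hp, hq, hq, hq, hδ,
          smul_lie, lie_smul, smul_smul, smul_lie, lie_smul, smul_smul, ← lie_skew x y,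
          add_smul, smul_neg, smul_neg, sub_eq_add_neg]
  -- The constant part of `F` fixes the generators, hence is the identity by `huniq`. The formula
  -- `hql` for the `ε`-part then becomes the Leibniz rule.
  obtain ⟨F, hF⟩ := hlift fun x => (1 : S) ⊗ₜ j x + ε ⊗ₜ f x
  have hpF : ∀ z, p (F z) = z := by
    let G : 𝔤 →ₗ⁅R⁆ 𝔤 :=
      { p ∘ₗ (F : 𝔤 →ₗ[R] S ⊗[R] 𝔤) with
        map_lie' := fun {x y} => by
          change p (F ⁅x, y⁆) = ⁅p (F x), p (F y)⁆
          rw [LieHom.map_lie, hpl] }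
    have hG : G = LieHom.id := by
      refine huniq _ fun x => ?_
      change p (F _) = _
      rw [hF, map_add, hp, hp]
      simp [hχε]
    exact fun z => LieHom.congr_fun hG z
  refine ⟨⟨q ∘ₗ (F : 𝔤 →ₗ[R] S ⊗[R] 𝔤), fun a b => ?_⟩, fun x => ?_⟩
  · change q (F ⁅a, b⁆) = ⁅a, q (F b)⁆ - ⁅b, q (F a)⁆
    rw [LieHom.map_lie, hql, hpF, hpF]
  · change q (F _) = _
    rw [hF, map_add, hq, hq]
    simp [hδε, hδ₁]

/-- Derivations of a free Lie algebra can be prescribed on the generators. -/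
theorem exists_derivation (f : X → FreeLieOn R X) :
    ∃ D : LieDerivation R (FreeLieOn R X) (FreeLieOn R X),
      ∀ x, D (FreeLieOn.of R x) = f x :=
  exists_derivation_of_lift (S := DualNumber R) (TrivSqZeroExt.fstHom R R R)
    (TrivSqZeroExt.sndHom R R) (fun s t => by simp [mul_comm]) DualNumber.eps (by simp) (by simp)
    (by simp) (FreeLieOn.of R)
    (fun h => ⟨FreeLieOn.lift R h, fun x => FreeLieOn.lift_of_apply h x⟩)
    (fun _ hG => FreeLieOn.hom_ext hG) f

theorem derivation_mem_weightPart {m : ℕ}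
    (D : LieDerivation R (FreeLieOn R X) (FreeLieOn R X))
    (hD : ∀ x, D (FreeLieOn.of R x) ∈ weightPart R w (w x + m)) (n : ℕ)
    (z : FreeLieOn R X) (hz : z ∈ weightPart R w n) : D z ∈ weightPart R w (n + m) := by
  refine weightPart_induction (w := w) (fun n => (weightPart R w (n + m)).comap
    (D : FreeLieOn R X →ₗ[R] FreeLieOn R X)) hD ?_ n hz
  intro a b x hx y hy hx' hy'
  change D ⁅x, y⁆ ∈ weightPart R w (a + b + m)
  rw [LieDerivation.apply_lie_eq_sub]
  refine sub_mem ?_ ?_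
  · rw [add_assoc]
    exact SetLike.GradedBracket.bracket_mem (ℒ := weightPart R w) hx hy'
  · rw [show a + b + m = b + (a + m) by ring]
    exact SetLike.GradedBracket.bracket_mem (ℒ := weightPart R w) hy hx'

/-- Since `d (x ∧ y) = -[x, y]`, brackets are boundaries, so the generators span the first homology.
-/
theorem exists_boundary_add_generators (n : ℕ) (b : FreeLieOn R X)
    (hb : b ∈ weightPart R w n) : ∃ η ∈ cePart R (weightPart R w) n 2, ∃ c : X →₀ R,
      ExteriorAlgebra.ι R b = d R η +
        ExteriorAlgebra.ι R (Finsupp.linearCombination R (FreeLieOn.of R) c) := by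
  induction hb using Submodule.span_induction with
  | mem z hz =>
    cases hz with
    | of x => exact ⟨0, zero_mem _, Finsupp.single x 1, by simp⟩
    | @lie p q x y hx hy =>
      refine ⟨-(ExteriorAlgebra.ι R x * ExteriorAlgebra.ι R y), neg_mem ?_, 0, ?_⟩
      · exact ι_mul_mem_cePart (Submodule.subset_span hx)
          (ι_mem_cePart (Submodule.subset_span hy))
      · simp [d_ι_mul_ι]
  | zero => exact ⟨0, zero_mem _, 0, by simp⟩
  | add x y _ _ h h' =>
    obtain ⟨η, hη, c, h⟩ := h
    obtain ⟨η', hη', c', h'⟩ := h'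
    refine ⟨η + η', add_mem hη hη', c + c', ?_⟩
    simp only [map_add, h, h']
    abel
  | smul r x _ h =>
    obtain ⟨η, hη, c, h⟩ := h
    refine ⟨r • η, Submodule.smul_mem _ _ hη, r • c, ?_⟩
    simp only [map_smul, h, smul_add]

attribute [local instance] LieRing.ofAssociativeRing

/-- The coefficient of a generator. -/
noncomputable def generatorCoeff (x : X) : FreeLieOn R X →ₗ[R] R :=
  open Classical in (FreeLieOn.lift R (Pi.single x (1 : R)) : FreeLieOn R X →ₗ⁅R⁆ R)

/-- The target `R` carries the commutator bracket of a commutative ring, which is zero. Hence the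
coefficient forms detect first homology classes. -/
theorem generatorCoeff_lie (x : X) (y z : FreeLieOn R X) :
    generatorCoeff x ⁅y, z⁆ = 0 := by
  rw [generatorCoeff, LieHom.coe_toLinearMap, LieHom.map_lie, Ring.lie_def, mul_comm, sub_self]

theorem generatorCoeff_linearCombination {Z : Type*} (f : Z → X) (hf : Function.Injective f)
    (c : Z →₀ R) (z : Z) :
    generatorCoeff (f z) (Finsupp.linearCombination R (fun z => FreeLieOn.of R (f z)) c) =
      c z := by
  classical
  induction c using Finsupp.induction_linear with
  | zero => simp
  | add a b ha hb => simp [ha, hb]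
  | single y r =>
    rw [Finsupp.linearCombination_single, map_smul, generatorCoeff,
      LieHom.coe_toLinearMap, FreeLieOn.lift_of_apply, Pi.single_apply, Finsupp.single_apply]
    by_cases h : y = z
    · simp [h]
    · simp [h, hf.ne h]

end FreeWeighted

/-! ### Elimination of a generator of a free Lie algebra -/

section FreeSplitting

attribute [local instance] LieRing.ofAssociativeRing

/-- The generators `(ad x₀)^i y`, `y ≠ x₀`, of the ideal complementary to the generator `x₀`. -/
abbrev SplitIndex {X : Type v} (x₀ : X) : Type v := ℕ × {y : X // y ≠ x₀}

/-- The weight of `(ad x₀)^i y`. -/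
def splitWeight {X : Type v} (w : X → ℕ) (x₀ : X) (p : SplitIndex x₀) : ℕ := p.1 * w x₀ + w p.2

/-- Elements of degree `n` in the semidirect product with a line in degree `m`. -/
def semiDirectPart {R : Type u} [CommRing R] {𝔨 : Type w} [LieRing 𝔨] [LieAlgebra R 𝔨]
    (𝒦 : ℕ → Submodule R 𝔨) (m : ℕ) (ψ : R →ₗ⁅R⁆ LieDerivation R 𝔨 𝔨) (n : ℕ) :
    Submodule R (LieAlgebra.SemiDirectSum 𝔨 R ψ) where
  carrier := {g | g.left ∈ 𝒦 n ∧ (n ≠ m → g.right = 0)}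
  zero_mem' := ⟨zero_mem _, fun _ => rfl⟩
  add_mem' := by
    rintro a b ⟨ha, ha'⟩ ⟨hb, hb'⟩
    refine ⟨add_mem ha hb, fun h => ?_⟩
    change a.right + b.right = 0
    rw [ha' h, hb' h, add_zero]
  smul_mem' := by
    rintro r a ⟨ha, ha'⟩
    refine ⟨Submodule.smul_mem _ _ ha, fun h => ?_⟩
    change r * a.right = 0
    rw [ha' h, mul_zero]

theorem semiDirectPart_gradedBracket {R : Type u} [CommRing R] {𝔨 : Type w} [LieRing 𝔨]
    [LieAlgebra R 𝔨] (𝒦 : ℕ → Submodule R 𝔨) [SetLike.GradedBracket 𝒦] (m : ℕ)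
    (ψ : R →ₗ⁅R⁆ LieDerivation R 𝔨 𝔨)
    (hψ : ∀ r n, ∀ k ∈ 𝒦 n, ψ r k ∈ 𝒦 (n + m)) :
    SetLike.GradedBracket (semiDirectPart 𝒦 m ψ) where
  bracket_mem := by
    rintro a b g h ⟨hg, hg'⟩ ⟨hh, hh'⟩
    refine ⟨?_, fun _ => ?_⟩
    · change ⁅g.left, h.left⁆ + ψ g.right h.left - ψ h.right g.left ∈ _
      refine sub_mem (add_mem (SetLike.GradedBracket.bracket_mem (ℒ := 𝒦) hg hh) ?_) ?_
      · by_cases ha : a = m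
        · rw [ha, add_comm]
          exact hψ _ _ _ hh
        · rw [hg' ha, map_zero]
          exact zero_mem _
      · by_cases hb : b = m
        · rw [hb]
          exact hψ _ _ _ hg
        · rw [hh' hb, map_zero]
          exact zero_mem _
    · change ⁅g.right, h.right⁆ = 0
      rw [Ring.lie_def, mul_comm, sub_self]

variable (R : Type u) [CommRing R] {X : Type v} (w : X → ℕ) (x₀ : X)

/-- Lazard elimination: the free Lie algebra is the semidirect product of the line spanned by a
generator `x₀` and the free Lie algebra on the elements `(ad x₀)^i y`, `y ≠ x₀`. -/
theorem exists_lineSplitting :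
    ∃ S : LineSplitting (weightPart R (splitWeight w x₀)) (weightPart R w) (w x₀),
      ∀ p, S.θ (FreeLieOn.of R p) = FreeLieOn.of R (p.1 + 1, p.2) := by
  classical
  let 𝔨 := FreeLieOn R (SplitIndex x₀)
  let 𝔤 := FreeLieOn R X
  let 𝒦 := weightPart R (splitWeight w x₀)
  -- The shift `(i, y) ↦ (i + 1, y)` is what bracketing with `x₀` does to `(ad x₀)^i y`. It defines
  -- the semidirect product before `𝔨` is known to embed in `𝔤`.
  obtain ⟨D, hD⟩ := exists_derivation (R := R)
    fun p : SplitIndex x₀ => FreeLieOn.of R ((p.1 + 1, p.2) : SplitIndex x₀)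
  have hDmem : ∀ n, ∀ k ∈ 𝒦 n, D k ∈ 𝒦 (n + w x₀) := by
    refine derivation_mem_weightPart D fun p => ?_
    have := of_mem_weightPart (R := R) (w := splitWeight w x₀) ((p.1 + 1, p.2) : SplitIndex x₀)
    have h : splitWeight w x₀ (p.1 + 1, p.2) = splitWeight w x₀ p + w x₀ := by
      simp only [splitWeight]
      ring
    rwa [h, ← hD] at this
  let ψ : R →ₗ⁅R⁆ LieDerivation R 𝔨 𝔨 :=
    { LinearMap.toSpanSingleton R _ D with
      map_lie' := fun {r s} => by
        change ⁅r, s⁆ • D = ⁅r • D, s • D⁆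
        refine LieDerivation.ext fun k => ?_
        rw [Ring.lie_def, mul_comm, sub_self, zero_smul, LieDerivation.commutator_apply]
        simp [smul_comm r s] }
  have hψ : ∀ r k, ψ r k = r • D k := fun r k => rfl
  let F : 𝔤 →ₗ⁅R⁆ LieAlgebra.SemiDirectSum 𝔨 R ψ := FreeLieOn.lift R fun x =>
    if h : x = x₀ then ⟨0, 1⟩ else ⟨FreeLieOn.of R (0, ⟨x, h⟩), 0⟩
  have hF₀ : F (FreeLieOn.of R x₀) = ⟨0, 1⟩ :=
    (FreeLieOn.lift_of_apply _ x₀).trans (dif_pos rfl)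
  have hF : ∀ y : {y // y ≠ x₀}, F (FreeLieOn.of R y.1) =
      ⟨FreeLieOn.of R (0, y), 0⟩ := fun y =>
    (FreeLieOn.lift_of_apply _ y.1).trans (dif_neg y.2)
  let κ : 𝔨 →ₗ⁅R⁆ 𝔤 := FreeLieOn.lift R fun p : SplitIndex x₀ =>
    (fun z => ⁅FreeLieOn.of R x₀, z⁆)^[p.1] (FreeLieOn.of R p.2.1)
  have hκ : ∀ p : SplitIndex x₀, κ (FreeLieOn.of R p) =
      (fun z => ⁅FreeLieOn.of R x₀, z⁆)^[p.1] (FreeLieOn.of R p.2.1) :=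
    fun p => FreeLieOn.lift_of_apply _ p
  -- Both sides satisfy the Leibniz rule along `κ` and agree on the generators.
  have hκD : ∀ k : 𝔨, κ (D k) = ⁅FreeLieOn.of R x₀, κ k⁆ := by
    intro k
    induction k using freeLieOn_induction with
    | zero => simp
    | add a b ha hb => rw [map_add, map_add, ha, hb, map_add, lie_add]
    | smul r a ha => rw [map_smul, map_smul, ha, map_smul, lie_smul]
    | of p => rw [hD, hκ, hκ, Function.iterate_succ_apply']
    | lie a b ha hb =>
      rw [LieDerivation.apply_lie_eq_add, map_add, LieHom.map_lie, LieHom.map_lie, ha, hb,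
        LieHom.map_lie, leibniz_lie (FreeLieOn.of R x₀), add_comm]
  have hFκ : ∀ k : 𝔨, F (κ k) = ⟨k, 0⟩ := by
    have : F.comp κ = LieAlgebra.SemiDirectSum.inl ψ := by
      ext1 ⟨i, y⟩
      rw [LieHom.comp_apply, hκ]
      change _ = (⟨_, 0⟩ : LieAlgebra.SemiDirectSum 𝔨 R ψ)
      induction i with
      | zero => exact hF y
      | succ i ih =>
        rw [Function.iterate_succ_apply', LieHom.map_lie, hF₀, ih]
        change (⟨⁅(0 : 𝔨), FreeLieOn.of R (i, y)⁆ + ψ 1 (FreeLieOn.of R (i, y)) - ψ 0 0, ⁅(1 : R), 0⁆⟩ :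
          LieAlgebra.SemiDirectSum 𝔨 R ψ) = _
        rw [hψ, hψ, hD, zero_lie, lie_zero]
        simp
    exact fun k => LieHom.congr_fun this k
  -- By `hκD` this is a homomorphism. As `E ∘ F` fixes the generators of `𝔤`, it is the identity,
  -- and this is the decomposition `z = κ (π z) + φ z • x₀` with `π` and `φ` the two components of
  -- `F`.
  let E : LieAlgebra.SemiDirectSum 𝔨 R ψ →ₗ⁅R⁆ 𝔤 :=
    { toFun := fun g => κ g.left + g.right • FreeLieOn.of R x₀
      map_add' := fun g h => by
        change κ (g.left + h.left) + (g.right + h.right) • FreeLieOn.of R x₀ = _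
        rw [map_add, add_smul]
        abel
      map_smul' := fun r g => by
        change κ (r • g.left) + (r * g.right) • FreeLieOn.of R x₀ = _
        rw [map_smul, mul_smul, RingHom.id_apply, smul_add]
      map_lie' := fun {g h} => by
        change κ (⁅g.left, h.left⁆ + ψ g.right h.left - ψ h.right g.left) +
          ⁅g.right, h.right⁆ • FreeLieOn.of R x₀ = _
        rw [Ring.lie_def, mul_comm, sub_self, zero_smul, hψ, hψ, map_sub, map_add, LieHom.map_lie,
          map_smul, map_smul, hκD, hκD]
        simp only [add_lie, lie_add, smul_lie, lie_smul, lie_self, smul_zero, add_zero]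
        rw [← lie_skew (κ g.left) (FreeLieOn.of R x₀), smul_neg]
        abel }
  have hEF : ∀ z, E (F z) = z := by
    have : E.comp F = LieHom.id := by
      ext x
      by_cases h : x = x₀
      · subst h
        rw [LieHom.comp_apply, hF₀]
        change κ 0 + (1 : R) • _ = _
        simp
      · rw [LieHom.comp_apply, hF ⟨x, h⟩]
        change κ _ + (0 : R) • _ = _
        rw [hκ]
        simp
    exact fun z => LieHom.congr_fun this z
  have : SetLike.GradedBracket (semiDirectPart 𝒦 (w x₀) ψ) :=
    semiDirectPart_gradedBracket 𝒦 (w x₀) ψ fun r n k hk =>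
      Submodule.smul_mem _ _ (hDmem n k hk)
  have hFmem : ∀ n, ∀ z ∈ weightPart R w n, F z ∈ semiDirectPart 𝒦 (w x₀) ψ n := by
    refine lift_mem _ _ fun x => ?_
    by_cases h : x = x₀
    · rw [dif_pos h, h]
      exact ⟨zero_mem _, fun h => absurd rfl h⟩
    · rw [dif_neg h]
      refine ⟨?_, fun _ => rfl⟩
      have := of_mem_weightPart (R := R) (w := splitWeight w x₀) ((0, ⟨x, h⟩) : SplitIndex x₀)
      simpa [splitWeight] using this
  let π : 𝔤 →ₗ[R] 𝔨 :=
    { toFun := fun z => (F z).left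
      map_add' := fun y z => by rw [map_add]; rfl
      map_smul' := fun r z => by rw [map_smul]; rfl }
  let φ : 𝔤 →ₗ[R] R :=
    { toFun := fun z => (F z).right
      map_add' := fun y z => by rw [map_add]; rfl
      map_smul' := fun r z => by rw [map_smul]; rfl }
  refine ⟨⟨κ, π, φ,
    FreeLieOn.of R x₀, D, ?_, ?_, ?_, ?_, hEF, hκD, ?_,
    fun n z hz => (hFmem n z hz).1, fun n h z hz => (hFmem n z hz).2 h,
    of_mem_weightPart x₀⟩, hD⟩
  · exact fun k => congrArg LieAlgebra.SemiDirectSum.left (hFκ k)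
  · exact fun k => congrArg LieAlgebra.SemiDirectSum.right (hFκ k)
  · exact congrArg LieAlgebra.SemiDirectSum.left hF₀
  · exact congrArg LieAlgebra.SemiDirectSum.right hF₀
  · refine lift_mem _ _ fun p => ?_
    obtain ⟨i, y⟩ := p
    induction i with
    | zero => simpa [splitWeight] using of_mem_weightPart (R := R) (w := w) y.1
    | succ i ih =>
      have := SetLike.GradedBracket.bracket_mem (ℒ := weightPart R w)
        (of_mem_weightPart (R := R) (w := w) x₀) ih
      have h : splitWeight w x₀ (i + 1, y) = w x₀ + splitWeight w x₀ (i, y) := by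
        simp only [splitWeight]
        ring
      rwa [← h, ← Function.iterate_succ_apply' (fun z => ⁅FreeLieOn.of R x₀, z⁆)] at this

variable {R} {w} {x₀}

/-- The first homology of `𝔨` is free on the generators, and `θ` permutes them injectively into
themselves. Modulo boundaries `b` is a combination `c` of generators; if `θ b` bounds, the
coefficient forms at the shifted generators show that `c = 0`. -/
theorem splitting_exact_one
    (S : LineSplitting (weightPart R (splitWeight w x₀)) (weightPart R w) (w x₀))
    (hS : ∀ p, S.θ (FreeLieOn.of R p) = FreeLieOn.of R (p.1 + 1, p.2)) (n : ℕ)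
    (b : FreeLieOn R (SplitIndex x₀)) (hb : b ∈ weightPart R (splitWeight w x₀) n)
    (h : ∃ α, ExteriorAlgebra.ι R (S.θ b) = d R α) :
    ∃ η ∈ cePart R (weightPart R (splitWeight w x₀)) n 2, d R η = ExteriorAlgebra.ι R b := by
  obtain ⟨η, hη, c, hc⟩ := exists_boundary_add_generators n b hb
  obtain ⟨α, hα⟩ := h
  let f : SplitIndex x₀ → SplitIndex x₀ := fun p => (p.1 + 1, p.2)
  have hf : Function.Injective f := by
    rintro ⟨i, y⟩ ⟨j, z⟩ h
    simpa [f] using h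
  have hθ : S.θ (Finsupp.linearCombination R (FreeLieOn.of R) c) =
      Finsupp.linearCombination R (fun p => FreeLieOn.of R (f p)) c := by
    rw [← LinearMap.comp_apply]
    congr 1
    ext p
    simp [hS, f]
  have hc₀ : c = 0 := by
    ext p
    rw [← generatorCoeff_linearCombination f hf c p, ← hθ]
    refine apply_eq_zero_of_ι_eq_d (generatorCoeff (f p)) (generatorCoeff_lie (f p)) _ (α - S.Θ η) ?_
    rw [map_sub, ← hα, ← S.Θ_ι, ← S.Θ_ι, ← S.Θ_d, hc, map_add, add_sub_cancel_left]
  exact ⟨η, hη, by rw [hc, hc₀]; simp⟩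

end FreeSplitting

/-! ### Exactness in degrees at least two, by repeated elimination -/

section Exactness

variable {R : Type u} [CommRing R]

/-- A wedge of at least two vectors of weight at least `m` has weight at least `2 * m`, which
exceeds `n`, so the pieces in question are zero. -/
theorem exactAbove_of_lt {X : Type v} {w : X → ℕ} {m n : ℕ} (hm : ∀ x, m ≤ w x) (hn : n < m) :
    ExactAbove (weightPart R w) n := by
  intro i ω hω _
  rw [cePart_eq_bot m (fun a ha => weightPart_eq_bot m hm ha) (by nlinarith)] at hω
  exact ⟨0, zero_mem _, by rw [(Submodule.mem_bot R).1 hω, map_zero]⟩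

/-- The weight bound `N` stays fixed while the least weight `m` rises, with `e` controlling how far
it still has to go. For each `m` an inner induction removes the `c` generators of weight exactly
`m`. Elimination produces infinitely many generators, so finiteness is asked only in each weight. -/
theorem exactAbove_weightPart_aux (N : ℕ) (e : ℕ) :
    ∀ m, 0 < m → N < m + e → ∀ (X : Type v) (w : X → ℕ), (∀ x, m ≤ w x) →
      (∀ k, {x | w x = k}.Finite) → ∀ n ≤ N, ExactAbove (weightPart R w) n := by
  induction e with
  | zero => exact fun m _ hN X w hw _ n hn => exactAbove_of_lt hw (by omega)
  | succ e ih =>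
    intro m hm hN
    suffices h : ∀ (c : ℕ) (X : Type v) (w : X → ℕ), (∀ x, m ≤ w x) →
        (∀ k, {x | w x = k}.Finite) → {x | w x = m}.ncard = c →
        ∀ n ≤ N, ExactAbove (weightPart R w) n from
      fun X w hw hfin => h _ X w hw hfin rfl
    intro c
    induction c with
    | zero =>
      intro X w hw hfin hc
      refine ih (m + 1) m.succ_pos (by omega) X w (fun x => ?_) hfin
      rw [Set.ncard_eq_zero (hfin m)] at hc
      exact Nat.lt_of_le_of_ne (hw x) fun h => (hc ▸ h.symm : x ∈ (∅ : Set X))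
    | succ c ihc =>
      intro X w hw hfin hc n hn
      by_cases hnm : n < m
      · exact exactAbove_of_lt hw hnm
      obtain ⟨x₀, rfl⟩ : ∃ x₀, w x₀ = m := by
        have : {x | w x = m}.Nonempty := by
          rw [Set.nonempty_iff_ne_empty]
          intro h
          simp [h] at hc
        exact this
      have hwY : ∀ p : SplitIndex x₀, w x₀ ≤ splitWeight w x₀ p := fun p =>
        (hw p.2).trans (Nat.le_add_left _ _)
      -- As `x₀` has positive weight, `(ad x₀)^i y` has weight `k` only if both `i` and the weight
      -- of `y` are at most `k`.
      have hfinY : ∀ k, {p : SplitIndex x₀ | splitWeight w x₀ p = k}.Finite := by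
        intro k
        refine Set.Finite.subset (((Set.finite_Iic k).prod
          ((Set.Finite.biUnion (Set.finite_Iic k) fun j _ => hfin j).preimage
            Subtype.val_injective.injOn))) ?_
        rintro ⟨i, y⟩ hp
        have hp' : i * w x₀ + w y = k := hp
        have : i ≤ i * w x₀ := Nat.le_mul_of_pos_right i hm
        simp only [Set.mem_prod, Set.mem_Iic, Set.mem_preimage, Set.mem_iUnion, Set.mem_ofPred_eq,
          exists_prop, exists_eq_right']
        omega
      -- For `i > 0` the weight of `(ad x₀)^i y` is at least twice the minimum. So the generators of
      -- least weight are the old ones other than `x₀`.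
      have hcY : {p : SplitIndex x₀ | splitWeight w x₀ p = w x₀}.ncard = c := by
        let g : SplitIndex x₀ → X := fun p => p.2.1
        have himg : g '' {p : SplitIndex x₀ | splitWeight w x₀ p = w x₀} =
            {x | w x = w x₀} \ {x₀} := by
          ext x
          constructor
          · rintro ⟨⟨i, y⟩, hp, rfl⟩
            refine ⟨?_, y.2⟩
            have hp' : i * w x₀ + w y = w x₀ := hp
            have : w x₀ ≤ w y := hw y
            change w y = w x₀
            exact le_antisymm (by omega) this
          · rintro ⟨hx, hx₀⟩
            refine ⟨(0, ⟨x, hx₀⟩), ?_, rfl⟩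
            simpa [splitWeight] using hx
        rw [← Set.InjOn.ncard_image (f := g), himg, Set.ncard_sdiff_singleton_of_mem, hc,
          Nat.add_sub_cancel]
        · rfl
        · rintro ⟨i, y⟩ hp ⟨j, z⟩ hq h
          have hp' : i * w x₀ + w y = w x₀ := hp
          have hq' : j * w x₀ + w z = w x₀ := hq
          have hy := hw y
          have hz := hw z
          have hi : i * w x₀ = 0 := by omega
          have hj : j * w x₀ = 0 := by omega
          rw [Nat.mul_eq_zero] at hi hj
          refine Prod.ext ?_ (Subtype.ext h)
          change i = j
          omega
      obtain ⟨S, hS⟩ := exists_lineSplitting R w x₀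
      obtain ⟨n', rfl⟩ := Nat.exists_eq_add_of_le' (not_lt.1 hnm)
      exact S.exactAbove (ihc _ _ hwY hfinY hcY _ hn) (ihc _ _ hwY hfinY hcY _ (by omega))
        (splitting_exact_one S hS n')

variable {X : Type v} (w : X → ℕ)

/-- The inclusion of the free Lie algebra on a subset. -/
noncomputable def subsetIncl (s : Set X) : FreeLieOn R s →ₗ⁅R⁆ FreeLieOn R X :=
  FreeLieOn.lift R fun x => FreeLieOn.of R x.1

open Classical in
/-- The projection to the free Lie algebra on a subset that kills the other generators. -/
noncomputable def subsetProj (s : Set X) : FreeLieOn R X →ₗ⁅R⁆ FreeLieOn R s :=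
  FreeLieOn.lift R fun x => if h : x ∈ s then FreeLieOn.of R ⟨x, h⟩ else 0

theorem subsetIncl_mem (s : Set X) (n : ℕ) (z : FreeLieOn R s)
    (hz : z ∈ weightPart R (fun x : s => w x) n) : subsetIncl s z ∈ weightPart R w n :=
  lift_mem (w := fun x : s => w x) (weightPart R w) (fun x => FreeLieOn.of R x.1)
    (fun x => of_mem_weightPart x.1) n z hz

theorem subsetProj_mem (s : Set X) (n : ℕ) (z : FreeLieOn R X)
    (hz : z ∈ weightPart R w n) : subsetProj s z ∈ weightPart R (fun x : s => w x) n := by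
  refine lift_mem _ _ (fun x => ?_) n z hz
  split_ifs with h
  · exact of_mem_weightPart (w := fun x : s => w x) ⟨x, h⟩
  · exact zero_mem _

/-- Each element involves finitely many generators. Allowing every larger set `t` makes the property
stable under unions, as sums and brackets require. -/
theorem exists_finset_subsetIncl_subsetProj (z : FreeLieOn R X) :
    ∃ s : Set X, s.Finite ∧ ∀ t, s ⊆ t →
      subsetIncl t (subsetProj t z) = z := by
  classical
  induction z using freeLieOn_induction with
  | zero => exact ⟨∅, Set.finite_empty, fun t _ => by simp⟩
  | add x y hx hy =>
    obtain ⟨s, hsf, hs⟩ := hx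
    obtain ⟨s', hsf', hs'⟩ := hy
    refine ⟨s ∪ s', hsf.union hsf', fun t ht => ?_⟩
    rw [map_add, map_add, hs t (Set.subset_union_left.trans ht), hs' t (Set.subset_union_right.trans ht)]
  | smul r x hx =>
    obtain ⟨s, hsf, hs⟩ := hx
    exact ⟨s, hsf, fun t ht => by rw [map_smul, map_smul, hs t ht]⟩
  | of x =>
    refine ⟨{x}, Set.finite_singleton x, fun t ht => ?_⟩
    have hx : x ∈ t := ht rfl
    rw [subsetProj, FreeLieOn.lift_of_apply, dif_pos hx, subsetIncl, FreeLieOn.lift_of_apply]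
  | lie x y hx hy =>
    obtain ⟨s, hsf, hs⟩ := hx
    obtain ⟨s', hsf', hs'⟩ := hy
    refine ⟨s ∪ s', hsf.union hsf', fun t ht => ?_⟩
    rw [LieHom.map_lie, LieHom.map_lie, hs t (Set.subset_union_left.trans ht),
      hs' t (Set.subset_union_right.trans ht)]

theorem exists_finset_map_subsetIncl_subsetProj (ω : ExteriorAlgebra R (FreeLieOn R X)) :
    ∃ s : Set X, s.Finite ∧ ∀ t, s ⊆ t →
      ExteriorAlgebra.map (subsetIncl (R := R) t : FreeLieOn R t →ₗ[R] FreeLieOn R X)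
        (ExteriorAlgebra.map (subsetProj (R := R) t : FreeLieOn R X →ₗ[R] FreeLieOn R t) ω) = ω := by
  classical
  induction ω using ext_induction with
  | one => exact ⟨∅, Set.finite_empty, fun t _ => by simp⟩
  | add x y hx hy =>
    obtain ⟨s, hsf, hs⟩ := hx
    obtain ⟨s', hsf', hs'⟩ := hy
    refine ⟨s ∪ s', hsf.union hsf', fun t ht => ?_⟩
    rw [map_add, map_add, hs t (Set.subset_union_left.trans ht), hs' t (Set.subset_union_right.trans ht)]
  | smul r x hx =>
    obtain ⟨s, hsf, hs⟩ := hx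
    exact ⟨s, hsf, fun t ht => by rw [map_smul, map_smul, hs t ht]⟩
  | mul z y hy =>
    obtain ⟨s, hsf, hs⟩ := exists_finset_subsetIncl_subsetProj z
    obtain ⟨s', hsf', hs'⟩ := hy
    refine ⟨s ∪ s', hsf.union hsf', fun t ht => ?_⟩
    rw [map_mul, map_mul, hs' t (Set.subset_union_right.trans ht), ExteriorAlgebra.map_apply_ι,
      ExteriorAlgebra.map_apply_ι]
    congr 2
    exact hs t (Set.subset_union_left.trans ht)

/-- The Chevalley–Eilenberg complex of a free Lie algebra is exact in degrees `≥ 2`. -/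
theorem exactAbove_weightPart (hw : ∀ x, 0 < w x) (n : ℕ) : ExactAbove (weightPart R w) n := by
  intro i ω hω hd
  obtain ⟨s, hsf, hs⟩ := exists_finset_map_subsetIncl_subsetProj ω
  replace hs := hs s le_rfl
  have := hsf.to_subtype
  -- The finite subset `s` provides the finiteness in each weight; positive weights allow the
  -- starting value `m = 1`, and `e = n` suffices since `n < 1 + n`.
  obtain ⟨η, hη, hdη⟩ := exactAbove_weightPart_aux (R := R) n n 1 one_pos (by omega)
    s (fun x => w x) (fun x => hw x) (fun k => Set.toFinite _) n le_rfl i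
    (ExteriorAlgebra.map (subsetProj (R := R) s : FreeLieOn R X →ₗ[R] FreeLieOn R s) ω)
    (map_mem R _ _ _ (subsetProj_mem w s) n _ ω hω) (by rw [← map_d, hd, map_zero])
  refine ⟨ExteriorAlgebra.map (subsetIncl (R := R) s : FreeLieOn R s →ₗ[R] FreeLieOn R X) η,
    map_mem R _ _ _ (subsetIncl_mem w s) n _ η hη, ?_⟩
  rw [← map_d, hdη, hs]

end Exactness

/-! ### Acyclicity -/

section Acyclic

variable {R : Type u} [CommRing R] {A : Type v} [AddCommGroup A] [Module R A]

theorem liePower_induction (P : ℕ → Submodule R (FreeLie R A))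
    (of : ∀ a, FreeLie.of R A a ∈ P 1)
    (lie : ∀ m n, ∀ x ∈ P m, ∀ y ∈ P n, ⁅x, y⁆ ∈ P (m + n)) (n : ℕ) :
    liePower R A n ≤ P n := by
  refine Submodule.span_le.2 fun z hz => ?_
  change z ∈ P n
  induction hz with
  | of x => exact of x
  | lie hx hy h h' => exact lie _ _ _ h _ h'

theorem freeLie_lift_mem {𝔤 : Type w'} [LieRing 𝔤] [LieAlgebra R 𝔤] (𝒢 : ℕ → Submodule R 𝔤)
    [SetLike.GradedBracket 𝒢] (f : A →ₗ[R] 𝔤) (hf : ∀ a, f a ∈ 𝒢 1) (n : ℕ)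
    (z : FreeLie R A) (hz : z ∈ liePower R A n) : FreeLie.lift f z ∈ 𝒢 n := by
  refine liePower_induction
    (fun n => (𝒢 n).comap (FreeLie.lift f : FreeLie R A →ₗ[R] 𝔤)) ?_ ?_ n hz
  · intro x
    simpa using hf x
  · intro m n x hx y hy
    simpa using SetLike.GradedBracket.bracket_mem (ℒ := 𝒢) hx hy

/-- Push a cycle forward along `F`, bound it there, and bring the bounding chain back along `G`.
Only the one-sided identity is needed. -/
theorem ExactAbove.of_retract {𝔤 𝔥 : Type w} [LieRing 𝔤] [LieAlgebra R 𝔤] [LieRing 𝔥]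
    [LieAlgebra R 𝔥] {𝒢 : ℕ → Submodule R 𝔤} {ℋ : ℕ → Submodule R 𝔥} (F : 𝔤 →ₗ⁅R⁆ 𝔥)
    (G : 𝔥 →ₗ⁅R⁆ 𝔤) (hGF : ∀ z, G (F z) = z) (hF : ∀ n, ∀ z ∈ 𝒢 n, F z ∈ ℋ n)
    (hG : ∀ n, ∀ z ∈ ℋ n, G z ∈ 𝒢 n) {n : ℕ} (h : ExactAbove ℋ n) : ExactAbove 𝒢 n := by
  intro i ω hω hd
  obtain ⟨η, hη, hdη⟩ := h i (ExteriorAlgebra.map (F : 𝔤 →ₗ[R] 𝔥) ω)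
    (map_mem R 𝒢 ℋ (F : 𝔤 →ₗ[R] 𝔥) hF n _ ω hω) (by rw [← map_d, hd, map_zero])
  refine ⟨ExteriorAlgebra.map (G : 𝔥 →ₗ[R] 𝔤) η,
    map_mem R ℋ 𝒢 (G : 𝔥 →ₗ[R] 𝔤) hG n _ η hη, ?_⟩
  have h : (G : 𝔥 →ₗ[R] 𝔤) ∘ₗ (F : 𝔤 →ₗ[R] 𝔥) = LinearMap.id := LinearMap.ext hGF
  rw [← map_d, hdη, ← AlgHom.comp_apply, ExteriorAlgebra.map_comp_map, h, ExteriorAlgebra.map_id,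
    AlgHom.id_apply]

/-- Freeness of `A` enters here: a basis makes `L^*(A)` a graded retract of the free Lie algebra on
the basis, all weights being 1. -/
theorem exactAbove_liePower [Module.Free R A] (n : ℕ) : ExactAbove (liePower R A) n := by
  let ι := Module.Free.ChooseBasisIndex R A
  let b : Module.Basis ι R A := Module.Free.chooseBasis R A
  let w : ι → ℕ := fun _ => 1
  let f : A →ₗ[R] FreeLieOn R ι := b.constr R (FreeLieOn.of R)
  let F : FreeLie R A →ₗ⁅R⁆ FreeLieOn R ι := FreeLie.lift f
  let G : FreeLieOn R ι →ₗ⁅R⁆ FreeLie R A := FreeLieOn.lift R fun i => FreeLie.of R A (b i)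
  have hGF : G.comp F = LieHom.id := by
    have : (G : FreeLieOn R ι →ₗ[R] FreeLie R A) ∘ₗ f = FreeLie.of R A := by
      refine b.ext fun i => ?_
      rw [LinearMap.comp_apply, Module.Basis.constr_basis]
      exact FreeLieOn.lift_of_apply _ i
    refine FreeLie.hom_ext fun a => ?_
    rw [LieHom.comp_apply, FreeLie.lift_of]
    exact LinearMap.congr_fun this a
  have hF : ∀ n, ∀ z ∈ liePower R A n, F z ∈ weightPart R w n := by
    refine freeLie_lift_mem (weightPart R w) f fun a => ?_
    rw [Module.Basis.constr_apply]
    exact Submodule.sum_mem _ fun i _ => Submodule.smul_mem _ _ (of_mem_weightPart (w := w) i)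
  have hG : ∀ n, ∀ z ∈ weightPart R w n, G z ∈ liePower R A n :=
    lift_mem (w := w) (liePower R A) (fun i => FreeLie.of R A (b i))
      fun i => Submodule.subset_span (IsCommutator.of (b i))
  exact (exactAbove_weightPart w (fun _ => one_pos) n).of_retract F G
    (LieHom.congr_fun hGF) hF hG

/-- A commutator of length at least two is a bracket `[x, y]` of homogeneous elements, and it is the
boundary of `-(x ∧ y)`. -/
theorem exists_d_eq_of_mem_cePart_one {n : ℕ} (hn : 2 ≤ n) {ω : ExteriorAlgebra R (FreeLie R A)}
    (hω : ω ∈ cePart R (liePower R A) n 1) : ∃ η ∈ cePart R (liePower R A) n 2, d R η = ω := by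
  obtain ⟨z, hz, rfl⟩ := mem_cePart_one hω
  clear hω
  refine (Submodule.span_le.2 ?_ : liePower R A n ≤
    ((cePart R (liePower R A) n 2).map (d R)).comap (ExteriorAlgebra.ι R)) hz
  intro z hz
  cases hz with
  | of a => omega
  | @lie p q x y hx hy =>
    refine ⟨-(ExteriorAlgebra.ι R x * ExteriorAlgebra.ι R y), neg_mem ?_, ?_⟩
    · exact ι_mul_mem_cePart (Submodule.subset_span hx) (ι_mem_cePart (Submodule.subset_span hy))
    · rw [map_neg, d_ι_mul_ι, neg_neg]

theorem cePart_liePower_eq_bot {n i : ℕ} (h : n < i) : cePart R (liePower R A) n i = ⊥ :=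
  cePart_eq_bot 1 (fun a ha => by rw [Nat.lt_one_iff.1 ha, liePower_zero]) (by omega)

theorem cePart_zero_eq_bot {n : ℕ} (hn : n ≠ 0) : cePart R (liePower R A) n 0 = ⊥ := by
  refine Submodule.span_eq_bot.2 ?_
  rintro _ ⟨x, deg, -, h, rfl⟩
  exact absurd h.symm (by simpa using hn)

end Acyclic

/-! ### From pointwise exactness to the complex of functors -/

section Functor

/-- Evaluation at an object preserves homology, and a functor with zero values is a zero object. -/
theorem functor_exact_of_evaluation {C : Type*} [Category C] {D : Type*} [Category D]
    [Abelian D] (S : ShortComplex (C ⥤ D))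
    (h : ∀ X, (S.map ((evaluation C D).obj X)).Exact) : S.Exact := by
  rw [ShortComplex.exact_iff_isZero_homology]
  refine CategoryTheory.Functor.isZero _ fun X => ?_
  exact ((ShortComplex.exact_iff_isZero_homology _).1 (h X)).of_iso
    (S.mapHomologyIso ((evaluation C D).obj X)).symm

variable (R : Type u) [CommRing R]

theorem ceFunctor_isZero {n i : ℕ} (h : ∀ A : FMod.{u, v} R,
    cePart R (liePower R A.obj) n i = ⊥) : Limits.IsZero (ceFunctor.{u, v} R n i) := by
  refine CategoryTheory.Functor.isZero _ fun A => ?_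
  have : Subsingleton (cePart R (liePower R A.obj) n i) := by
    rw [h A]
    infer_instance
  exact ModuleCat.isZero_of_subsingleton (ModuleCat.of R (cePart R (liePower R A.obj) n i))

theorem ceComplex_isZero {n i : ℕ} (hn : 2 ≤ n) (h : i = 0 ∨ n < i) :
    Limits.IsZero ((ceComplex.{u, v} R n).X i) := by
  refine ceFunctor_isZero R fun A => ?_
  obtain rfl | h := h
  · exact cePart_zero_eq_bot (by omega)
  · exact cePart_liePower_eq_bot h

theorem ceComplex_d (n i : ℕ) : (ceComplex.{u, v} R n).d (i + 1) i = ceDiff R n i :=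
  ChainComplex.of_d (ceFunctor R n) (ceDiff R n) i

theorem ceComplex_acyclic {n : ℕ} (hn : 2 ≤ n) : (ceComplex.{u, v} R n).Acyclic := by
  intro i
  cases i with
  | zero =>
    exact ShortComplex.exact_of_isZero_X₂ _ (ceComplex_isZero R hn (Or.inl rfl))
  | succ i =>
    rw [HomologicalComplex.exactAt_iff' _ (i + 2) (i + 1) i (by simp) (by simp)]
    refine functor_exact_of_evaluation _ fun A => ?_
    rw [ShortComplex.moduleCat_exact_iff]
    intro x hx
    change cePart R (liePower R A.obj) n (i + 1) at x
    have hd : d R x.1 = 0 := by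
      change (((ceComplex R n).d (i + 1) i).app A).hom x = 0 at hx
      rw [ceComplex_d] at hx
      exact congrArg Subtype.val hx
    have hfree : Module.Free R A.obj := A.property
    obtain ⟨η, hη, hdη⟩ : ∃ η ∈ cePart R (liePower R A.obj) n (i + 2), d R η = x.1 := by
      cases i with
      | zero => exact exists_d_eq_of_mem_cePart_one hn x.2
      | succ i => exact exactAbove_liePower n i x.1 x.2 hd
    refine ⟨(⟨η, hη⟩ : cePart R (liePower R A.obj) n (i + 2)), ?_⟩
    change (((ceComplex R n).d (i + 1 + 1) (i + 1)).app A).hom _ = x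
    rw [ceComplex_d]
    exact Subtype.ext hdη

end Functor

/-! ### The exterior algebra of a direct sum -/

section ExteriorTensor

variable {R : Type u} [CommRing R]

/-- The grade involution of an exterior algebra. -/
noncomputable def signInv (N : Type w) [AddCommGroup N] [Module R N] :
    ExteriorAlgebra R N →ₐ[R] ExteriorAlgebra R N :=
  CliffordAlgebra.involute (Q := (0 : QuadraticForm R N))

theorem signInv_ι {N : Type w} [AddCommGroup N] [Module R N] (x : N) :
    signInv N (ExteriorAlgebra.ι R x) = -ExteriorAlgebra.ι R x :=
  CliffordAlgebra.involute_ι (Q := (0 : QuadraticForm R N)) x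

/-- Moving a vector past an element of degree `k` costs the sign `(-1)^k`, which is the value of the
grade involution. -/
theorem signInv_mul_ι {N : Type w} [AddCommGroup N] [Module R N] (ω : ExteriorAlgebra R N)
    (x : N) : signInv N ω * ExteriorAlgebra.ι R x = ExteriorAlgebra.ι R x * ω := by
  induction ω using ext_induction with
  | one => simp
  | add a b ha hb => rw [map_add, add_mul, ha, hb, mul_add]
  | smul r a ha => rw [map_smul, smul_mul_assoc, ha, mul_smul_comm]
  | mul y a ha => rw [map_mul, signInv_ι, mul_assoc, ha, neg_mul, ι_mul_ι_mul, neg_neg]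

theorem map_signInv {N : Type w} [AddCommGroup N] [Module R N] {M : Type w'} [AddCommGroup M]
    [Module R M] (f : N →ₗ[R] M) (ω : ExteriorAlgebra R N) :
    ExteriorAlgebra.map f (signInv N ω) = signInv M (ExteriorAlgebra.map f ω) := by
  induction ω using ext_induction with
  | one => simp
  | add a b ha hb => simp only [map_add, ha, hb]
  | smul r a ha => simp only [map_smul, ha]
  | mul y a ha => simp only [map_mul, signInv_ι, ExteriorAlgebra.map_apply_ι, map_neg, ha]

theorem signInv_mem {N : Type w} [AddCommGroup N] [Module R N] {k : ℕ}
    {ω : ExteriorAlgebra R N} (hω : ω ∈ ⋀[R]^k N) : signInv N ω ∈ ⋀[R]^k N := by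
  have h : (LinearMap.range (ExteriorAlgebra.ι R : N →ₗ[R] _) ^ k).map
      (signInv N : ExteriorAlgebra R N →ₐ[R] ExteriorAlgebra R N).toLinearMap ≤ ⋀[R]^k N := by
    rw [Submodule.map_pow]
    refine pow_le_pow_left' ?_ k
    rintro _ ⟨_, ⟨x, rfl⟩, rfl⟩
    exact ⟨-x, by rw [map_neg]; exact (signInv_ι x).symm⟩
  exact h ⟨ω, hω, rfl⟩

theorem ι_mul_mem {N : Type w} [AddCommGroup N] [Module R N] {k : ℕ} (x : N)
    {ω : ExteriorAlgebra R N} (hω : ω ∈ ⋀[R]^k N) :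
    ExteriorAlgebra.ι R x * ω ∈ ⋀[R]^(k + 1) N := by
  change _ ∈ LinearMap.range (ExteriorAlgebra.ι R : N →ₗ[R] _) ^ (k + 1)
  rw [pow_succ']
  exact Submodule.mul_mem_mul ⟨x, rfl⟩ hω

/-- Squares vanish and cross terms cancel in pairs. Squares are assumed to vanish separately because
2 need not be invertible. -/
theorem sum_mul_sum_eq_zero {S ι : Type*} [Ring S] (a : ι → S) (h : ∀ i, a i * a i = 0)
    (h' : ∀ i j, i ≠ j → a i * a j + a j * a i = 0) (s : Finset ι) :
    (∑ i ∈ s, a i) * ∑ i ∈ s, a i = 0 := by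
  classical
  induction s using Finset.induction_on with
  | empty => simp
  | insert i s hi ih =>
    rw [Finset.sum_insert hi, add_mul, mul_add, mul_add, h, ih, zero_add, add_zero,
      Finset.mul_sum, Finset.sum_mul, ← Finset.sum_add_distrib]
    exact Finset.sum_eq_zero fun j hj => h' i j fun hij => hi (hij ▸ hj)

/-- Moving a vector into the `j`-th factor of a product. -/
theorem prod_ofFn_eq_ι_mul {M : Type w} [AddCommGroup M] [Module R M] (y : M) {n : ℕ}
    (j : Fin n) (f g : Fin n → ExteriorAlgebra R M) (hlt : ∀ i < j, g i = signInv M (f i))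
    (heq : g j = ExteriorAlgebra.ι R y * f j) (hgt : ∀ i, j < i → g i = f i) :
    (List.ofFn g).prod = ExteriorAlgebra.ι R y * (List.ofFn f).prod := by
  induction n with
  | zero => exact j.elim0
  | succ n ih =>
    rw [List.ofFn_succ, List.ofFn_succ, List.prod_cons, List.prod_cons]
    induction j using Fin.cases with
    | zero =>
      rw [heq, mul_assoc]
      congr 4
      exact funext fun i => hgt _ i.succ_pos
    | succ j =>
      rw [ih j (fun i => f i.succ) (fun i => g i.succ)
        (fun i hi => hlt _ (Fin.succ_lt_succ_iff.2 hi)) heq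
        (fun i hi => hgt _ (Fin.succ_lt_succ_iff.2 hi)), hlt 0 j.succ_pos, ← mul_assoc,
        signInv_mul_ι, mul_assoc]

variable {n : ℕ} {N : Fin n → Type w} [∀ j, AddCommGroup (N j)] [∀ j, Module R (N j)]

variable (R N) in
/-- The tensor product of the exterior algebras of the summands. -/
abbrev ExtTensor : Type (max u w) := ⨂[R] j, ExteriorAlgebra R (N j)

/-- Left multiplication by `x` in the `j`-th factor, with the sign rule. -/
noncomputable def insertAt (j : Fin n) (x : N j) (η : ∀ i, ExteriorAlgebra R (N i)) (i : Fin n) :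
    ExteriorAlgebra R (N i) :=
  Function.update (β := fun i => ExteriorAlgebra R (N i) →ₗ[R] ExteriorAlgebra R (N i))
    (fun i => if i < j then (signInv (N i)).toLinearMap else LinearMap.id) j
    (LinearMap.mulLeft R (ExteriorAlgebra.ι R x)) i (η i)

theorem insertAt_self (j : Fin n) (x : N j) (η : ∀ i, ExteriorAlgebra R (N i)) :
    insertAt j x η j = ExteriorAlgebra.ι R x * η j := by
  simp [insertAt]

theorem insertAt_of_lt {i j : Fin n} (h : i < j) (x : N j) (η : ∀ i, ExteriorAlgebra R (N i)) :
    insertAt j x η i = signInv (N i) (η i) := by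
  simp [insertAt, h.ne, h]

theorem insertAt_of_gt {i j : Fin n} (h : j < i) (x : N j) (η : ∀ i, ExteriorAlgebra R (N i)) :
    insertAt j x η i = η i := by
  simp [insertAt, h.ne', h.not_gt]

/-- The operator `insertAt` on the tensor product. -/
noncomputable def insertOp (j : Fin n) : N j →ₗ[R] Module.End R (ExtTensor R N) :=
  (PiTensorProduct.mapMultilinear R (fun i => ExteriorAlgebra R (N i))
    (fun i => ExteriorAlgebra R (N i))).toLinearMap
      (fun i => if i < j then (signInv (N i)).toLinearMap else LinearMap.id) j ∘ₗ
    LinearMap.mul R (ExteriorAlgebra R (N j)) ∘ₗ ExteriorAlgebra.ι R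

theorem insertOp_tprod (j : Fin n) (x : N j) (η : ∀ i, ExteriorAlgebra R (N i)) :
    insertOp j x (PiTensorProduct.tprod R η) = PiTensorProduct.tprod R (insertAt j x η) :=
  PiTensorProduct.map_tprod _ _

theorem insertOp_mul_self (j : Fin n) (x y : N j)
    (h : ExteriorAlgebra.ι R x * ExteriorAlgebra.ι R y = 0) :
    insertOp (R := R) j x * insertOp j y = 0 := by
  refine PiTensorProduct.ext (MultilinearMap.ext fun η => ?_)
  change insertOp j x (insertOp j y (PiTensorProduct.tprod R η)) = 0
  rw [insertOp_tprod, insertOp_tprod]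
  refine MultilinearMap.map_coord_zero _ j ?_
  rw [insertAt_self, insertAt_self, ← mul_assoc, h, zero_mul]

/-- Inserting at the later place `j` applies the grade involution to factor `i`, which changes the
sign of `x` if `x` is already there. Elsewhere the two orders agree. -/
theorem insertOp_mul_add_of_lt {i j : Fin n} (h : i < j) (x : N i) (y : N j) :
    insertOp (R := R) i x * insertOp j y + insertOp j y * insertOp i x = 0 := by
  refine PiTensorProduct.ext (MultilinearMap.ext fun η => ?_)
  change insertOp i x (insertOp j y (PiTensorProduct.tprod R η)) +
    insertOp j y (insertOp i x (PiTensorProduct.tprod R η)) = 0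
  rw [insertOp_tprod, insertOp_tprod, insertOp_tprod, insertOp_tprod]
  have : insertAt j y (insertAt i x η) =
      Function.update (insertAt i x (insertAt j y η)) i (-insertAt i x (insertAt j y η) i) := by
    funext k
    rcases lt_trichotomy k i with hk | rfl | hk
    · rw [Function.update_of_ne hk.ne, insertAt_of_lt (hk.trans h), insertAt_of_lt hk,
        insertAt_of_lt hk, insertAt_of_lt (hk.trans h)]
    · rw [Function.update_self, insertAt_of_lt h, insertAt_self, insertAt_self, insertAt_of_lt h,
        map_mul, signInv_ι, neg_mul]
    · rw [Function.update_of_ne hk.ne', insertAt_of_gt hk]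
      rcases lt_trichotomy k j with hk' | rfl | hk'
      · rw [insertAt_of_lt hk', insertAt_of_lt hk', insertAt_of_gt hk]
      · rw [insertAt_self, insertAt_self, insertAt_of_gt hk]
      · rw [insertAt_of_gt hk', insertAt_of_gt hk', insertAt_of_gt hk]
  rw [this, MultilinearMap.map_update_neg, Function.update_eq_self, add_neg_cancel]

variable {M : Type w'} [AddCommGroup M] [Module R M]

/-- The action of `Λ M` on the tensor product. -/
noncomputable def extAction (pr : ∀ j, M →ₗ[R] N j) :
    ExteriorAlgebra R M →ₐ[R] Module.End R (ExtTensor R N) :=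
  ExteriorAlgebra.lift R ⟨∑ j, insertOp j ∘ₗ pr j, fun m => by
    simp only [LinearMap.sum_apply, LinearMap.comp_apply]
    refine sum_mul_sum_eq_zero _ (fun j => ?_) (fun i j hij => ?_) _
    · exact insertOp_mul_self j _ _ (ExteriorAlgebra.ι_sq_zero _)
    · rcases lt_or_gt_of_ne hij with h | h
      · exact insertOp_mul_add_of_lt h _ _
      · rw [add_comm]
        exact insertOp_mul_add_of_lt h _ _⟩

theorem extAction_ι (pr : ∀ j, M →ₗ[R] N j) (m : M) :
    extAction pr (ExteriorAlgebra.ι R m) = ∑ j, insertOp j (pr j m) := by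
  rw [extAction, ExteriorAlgebra.lift_ι_apply]
  simp

/-- Multiplication of the factors in the exterior algebra of `M`. -/
noncomputable def extMul (incl : ∀ j, N j →ₗ[R] M) : ExtTensor R N →ₗ[R] ExteriorAlgebra R M :=
  PiTensorProduct.lift ((MultilinearMap.mkPiAlgebraFin R n (ExteriorAlgebra R M)).compLinearMap
    fun j => (ExteriorAlgebra.map (incl j)).toLinearMap)

theorem extMul_tprod (incl : ∀ j, N j →ₗ[R] M) (η : ∀ i, ExteriorAlgebra R (N i)) :
    extMul incl (PiTensorProduct.tprod R η) =
      (List.ofFn fun j => ExteriorAlgebra.map (incl j) (η j)).prod := by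
  rw [extMul, PiTensorProduct.lift.tprod]
  simp

/-- The involutions in the insertion operator are the signs of moving `x` from the front to factor
`j`. This lets left multiplication be lifted to the tensor product. -/
theorem extMul_insertOp (incl : ∀ j, N j →ₗ[R] M) (j : Fin n) (x : N j) (τ : ExtTensor R N) :
    extMul incl (insertOp j x τ) = ExteriorAlgebra.ι R (incl j x) * extMul incl τ := by
  have : extMul incl ∘ₗ insertOp j x =
      LinearMap.mulLeft R (ExteriorAlgebra.ι R (incl j x)) ∘ₗ extMul incl := by
    refine PiTensorProduct.ext (MultilinearMap.ext fun η => ?_)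
    change extMul incl (insertOp j x (PiTensorProduct.tprod R η)) =
      ExteriorAlgebra.ι R (incl j x) * extMul incl (PiTensorProduct.tprod R η)
    rw [insertOp_tprod, extMul_tprod, extMul_tprod]
    refine prod_ofFn_eq_ι_mul _ j _ _ (fun i hi => ?_) ?_ (fun i hi => ?_)
    · rw [insertAt_of_lt hi, map_signInv]
    · rw [insertAt_self, map_mul, ExteriorAlgebra.map_apply_ι]
    · rw [insertAt_of_gt hi]
  exact LinearMap.congr_fun this τ

section LeftInverse

variable {incl : ∀ j, N j →ₗ[R] M} {pr : ∀ j, M →ₗ[R] N j}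

/-- A vector from `N j` acts only through the `j`-th insertion operator. The factors to its left are
1, so the involutions do nothing. -/
theorem extAction_map_tprod (h : ∀ j x, pr j (incl j x) = x)
    (h' : ∀ i j x, i ≠ j → pr i (incl j x) = 0) (j : Fin n) (ω : ExteriorAlgebra R (N j))
    (ζ : ∀ i, ExteriorAlgebra R (N i)) (hζ : ∀ i < j, ζ i = 1) :
    extAction pr (ExteriorAlgebra.map (incl j) ω) (PiTensorProduct.tprod R ζ) =
      PiTensorProduct.tprod R (Function.update ζ j (ω * ζ j)) := by
  induction ω using ext_induction with
  | one => simp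
  | add a b ha hb =>
    rw [map_add, map_add, LinearMap.add_apply, ha, hb, add_mul, MultilinearMap.map_update_add]
  | smul r a ha =>
    rw [map_smul, map_smul, LinearMap.smul_apply, ha, smul_mul_assoc,
      MultilinearMap.map_update_smul]
  | mul x a ha =>
    rw [map_mul, map_mul, Module.End.mul_apply, ha, ExteriorAlgebra.map_apply_ι, extAction_ι,
      Finset.sum_eq_single j, h, insertOp_tprod]
    · congr 1
      funext i
      rcases lt_trichotomy i j with hi | rfl | hi
      · rw [insertAt_of_lt hi, Function.update_of_ne hi.ne, Function.update_of_ne hi.ne, hζ i hi,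
          map_one]
      · rw [insertAt_self, Function.update_self, Function.update_self, mul_assoc]
      · rw [insertAt_of_gt hi, Function.update_of_ne hi.ne', Function.update_of_ne hi.ne']
    · intro i _ hi
      rw [h' i j x hi, map_zero]
    · simp

/-- A product of factors acts on `1 ⊗ … ⊗ 1` from the last factor to the first, so each finds only
ones to its left and fills its own place. This gives a left inverse of multiplication. -/
theorem extAction_extMul (h : ∀ j x, pr j (incl j x) = x)
    (h' : ∀ i j x, i ≠ j → pr i (incl j x) = 0) (τ : ExtTensor R N) :
    extAction pr (extMul incl τ) (PiTensorProduct.tprod R fun _ => 1) = τ := by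
  have : (LinearMap.applyₗ (PiTensorProduct.tprod R fun _ => 1) :
      Module.End R (ExtTensor R N) →ₗ[R] ExtTensor R N) ∘ₗ (extAction pr).toLinearMap ∘ₗ
      extMul incl = LinearMap.id := by
    refine PiTensorProduct.ext (MultilinearMap.ext fun η => ?_)
    change extAction pr (extMul incl (PiTensorProduct.tprod R η)) _ = PiTensorProduct.tprod R η
    rw [extMul_tprod]
    have key : ∀ m k : ℕ, k + m = n →
        extAction pr ((List.ofFn fun j => ExteriorAlgebra.map (incl j) (η j)).drop k).prod
          (PiTensorProduct.tprod R fun _ => 1) =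
        PiTensorProduct.tprod R fun i : Fin n => if k ≤ (i : ℕ) then η i else 1 := by
      intro m
      induction m with
      | zero =>
        rintro k rfl
        rw [List.drop_of_length_le (by simp), List.prod_nil, map_one, Module.End.one_apply]
        congr 1
        funext i
        rw [if_neg (by omega)]
      | succ m ih =>
        intro k hk
        have hkn : k < n := by omega
        rw [List.drop_eq_getElem_cons (by simpa only [List.length_ofFn] using hkn), List.prod_cons, map_mul,
          Module.End.mul_apply, ih (k + 1) (by omega), List.getElem_ofFn,
          extAction_map_tprod h h' ⟨k, hkn⟩]
        · congr 1
          funext i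
          by_cases hi : i = ⟨k, hkn⟩
          · subst hi
            simp
          · have : (i : ℕ) ≠ k := fun hik => hi (Fin.ext hik)
            rw [Function.update_of_ne hi]
            by_cases hki : k ≤ (i : ℕ)
            · rw [if_pos hki, if_pos (by omega)]
            · rw [if_neg hki, if_neg (by omega)]
        · intro i hi
          have : (i : ℕ) < k := hi
          rw [if_neg (by omega)]
    simpa using key n 0 (zero_add n)
  exact LinearMap.congr_fun this τ

end LeftInverse

/-! Homogeneous components -/

variable (R N) in
/-- The homogeneous tensors of multidegree `k`. -/
abbrev HomTensor (k : Fin n → ℕ) : Type (max u w) := ⨂[R] j, ⋀[R]^(k j) (N j)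

/-- The inclusion of the homogeneous tensors of multidegree `k`. -/
noncomputable def homIncl (k : Fin n → ℕ) : HomTensor R N k →ₗ[R] ExtTensor R N :=
  PiTensorProduct.map fun j => (⋀[R]^(k j) (N j)).subtype

theorem homIncl_tprod (k : Fin n → ℕ) (η : ∀ j, ⋀[R]^(k j) (N j)) :
    homIncl k (PiTensorProduct.tprod R η) = PiTensorProduct.tprod R fun j => (η j).1 :=
  PiTensorProduct.map_tprod _ _

/-- The projection to the homogeneous tensors of multidegree `k`. -/
noncomputable def homProj (k : Fin n → ℕ) : ExtTensor R N →ₗ[R] HomTensor R N k :=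
  PiTensorProduct.map fun j => DirectSum.component R ℕ (fun i => ⋀[R]^i (N j)) (k j) ∘ₗ
    (DirectSum.decomposeLinearEquiv fun i => ⋀[R]^i (N j)).toLinearMap

theorem homProj_homIncl_self (k : Fin n → ℕ) (x : HomTensor R N k) :
    homProj k (homIncl k x) = x := by
  have : homProj k ∘ₗ homIncl k = (LinearMap.id : HomTensor R N k →ₗ[R] _) := by
    refine PiTensorProduct.ext (MultilinearMap.ext fun η => ?_)
    change homProj k (homIncl k (PiTensorProduct.tprod R η)) = PiTensorProduct.tprod R η
    rw [homIncl_tprod, homProj, PiTensorProduct.map_tprod]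
    congr 1
    funext j
    change DirectSum.component R ℕ _ (k j)
      (DirectSum.decompose (fun i => ⋀[R]^i (N j)) (η j).1) = η j
    rw [DirectSum.decompose_coe]
    exact DirectSum.component.lof_self R _ _
  exact LinearMap.congr_fun this x

theorem homProj_homIncl_of_ne {k l : Fin n → ℕ} (hkl : k ≠ l) (x : HomTensor R N k) :
    homProj l (homIncl k x) = 0 := by
  have : homProj l ∘ₗ homIncl k = (0 : HomTensor R N k →ₗ[R] _) := by
    refine PiTensorProduct.ext (MultilinearMap.ext fun η => ?_)
    change homProj l (homIncl k (PiTensorProduct.tprod R η)) = 0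
    rw [homIncl_tprod, homProj, PiTensorProduct.map_tprod]
    obtain ⟨j, hj⟩ := Function.ne_iff.1 hkl
    refine MultilinearMap.map_coord_zero _ j ?_
    change DirectSum.component R ℕ _ (l j)
      (DirectSum.decompose (fun i => ⋀[R]^i (N j)) (η j).1) = 0
    rw [DirectSum.decompose_coe]
    exact DirectSum.of_eq_of_ne _ _ _ hj.symm
  exact LinearMap.congr_fun this x

theorem tprod_mem_range_homIncl {k : Fin n → ℕ} {η : ∀ j, ExteriorAlgebra R (N j)}
    (hη : ∀ j, η j ∈ ⋀[R]^(k j) (N j)) :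
    PiTensorProduct.tprod R η ∈ LinearMap.range (homIncl (R := R) (N := N) k) :=
  ⟨PiTensorProduct.tprod R fun j => ⟨η j, hη j⟩, homIncl_tprod _ _⟩

theorem insertOp_mem_range_homIncl {k : Fin n → ℕ} (j : Fin n) (x : N j) {τ : ExtTensor R N}
    (hτ : τ ∈ LinearMap.range (homIncl (R := R) (N := N) k)) :
    insertOp j x τ ∈ LinearMap.range (homIncl (R := R) (N := N) (k + Pi.single j 1)) := by
  obtain ⟨τ, rfl⟩ := hτ
  induction τ using PiTensorProduct.induction_on with
  | smul_tprod r η =>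
    rw [map_smul, map_smul, homIncl_tprod, insertOp_tprod]
    refine Submodule.smul_mem _ _ (tprod_mem_range_homIncl fun i => ?_)
    rcases lt_trichotomy i j with hi | rfl | hi
    · rw [insertAt_of_lt hi, Pi.add_apply, Pi.single_eq_of_ne hi.ne]
      exact signInv_mem (η i).2
    · rw [insertAt_self, Pi.add_apply, Pi.single_eq_same]
      exact ι_mul_mem x (η i).2
    · rw [insertAt_of_gt hi, Pi.add_apply, Pi.single_eq_of_ne hi.ne']
      exact (η i).2
  | add a b ha hb =>
    rw [map_add, map_add]
    exact add_mem ha hb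

end ExteriorTensor

/-! ### The decomposition of the graded pieces -/

section Projections

variable {R : Type u} [CommRing R] {A : Type v} [AddCommGroup A] [Module R A]

/-- The sum of the Lie powers is a Lie subalgebra containing `A`, so the identity of `L^*(A)`
factors through it. -/
theorem mem_iSup_liePower (z : FreeLie R A) : z ∈ ⨆ m, liePower R A m := by
  let Q : LieSubalgebra R (FreeLie R A) :=
    { (⨆ m, liePower R A m) with
      lie_mem' := fun {x y} hx hy => by
        change x ∈ ⨆ m, liePower R A m at hx
        change y ∈ ⨆ m, liePower R A m at hy
        change ⁅x, y⁆ ∈ ⨆ m, liePower R A m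
        induction hx using Submodule.iSup_induction' with
        | zero => rw [zero_lie]; exact zero_mem _
        | add a b _ _ ha hb => rw [add_lie]; exact add_mem ha hb
        | mem p x hx =>
          induction hy using Submodule.iSup_induction' with
          | zero => rw [lie_zero]; exact zero_mem _
          | add a b _ _ ha hb => rw [lie_add]; exact add_mem ha hb
          | mem q y hy =>
            exact Submodule.mem_iSup_of_mem (p + q)
              (SetLike.GradedBracket.bracket_mem (ℒ := liePower R A) hx hy) }
  let f : A →ₗ[R] Q := (FreeLie.of R A).codRestrict Q.toSubmodule fun a =>
    Submodule.mem_iSup_of_mem (p := liePower R A) 1 (Submodule.subset_span (IsCommutator.of a))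
  have h : Q.incl.comp (FreeLie.lift f) = LieHom.id := by
    refine FreeLie.hom_ext fun a => ?_
    rw [LieHom.comp_apply, FreeLie.lift_of]
    rfl
  have h' := LieHom.congr_fun h z
  rw [LieHom.id_apply] at h'
  rw [← h']
  exact (FreeLie.lift f z).2

/-- The homomorphism extending `a ↦ t ⊗ a` multiplies `m`-fold commutators by `t ^ m`; the form `c`
brings the result back to `L^*(A)`. -/
theorem exists_scaling {S : Type u} [CommRing S] [Algebra R S] (t : S) (c : S →ₗ[R] R) :
    ∃ q : FreeLie R A →ₗ[R] FreeLie R A, ∀ m, ∀ z ∈ liePower R A m, q z = c (t ^ m) • z := by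
  let F : FreeLie R A →ₗ⁅R⁆ S ⊗[R] FreeLie R A :=
    FreeLie.lift ((TensorProduct.mk R S (FreeLie R A) t) ∘ₗ FreeLie.of R A)
  have hF : ∀ m, ∀ z ∈ liePower R A m, F z = (t ^ m) ⊗ₜ z := by
    refine fun m => liePower_induction (fun m => LinearMap.eqLocus
      (F : FreeLie R A →ₗ[R] S ⊗[R] FreeLie R A) (TensorProduct.mk R S (FreeLie R A) (t ^ m)))
      (fun a => ?_) (fun m n x hx y hy => ?_) m
    · change F _ = (t ^ 1) ⊗ₜ _
      rw [pow_one]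
      exact FreeLie.lift_of _ a
    · change F x = (t ^ m) ⊗ₜ x at hx
      change F y = (t ^ n) ⊗ₜ y at hy
      change F ⁅x, y⁆ = (t ^ (m + n)) ⊗ₜ ⁅x, y⁆
      rw [LieHom.map_lie, hx, hy, LieAlgebra.ExtendScalars.bracket_tmul, pow_add]
  refine ⟨(TensorProduct.lid R (FreeLie R A)).toLinearMap ∘ₗ LinearMap.rTensor _ c ∘ₗ
    (F : FreeLie R A →ₗ[R] S ⊗[R] FreeLie R A), fun m z hz => ?_⟩
  change TensorProduct.lid R (FreeLie R A) (LinearMap.rTensor _ c (F z)) = _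
  rw [hF m z hz, LinearMap.rTensor_tmul, TensorProduct.lid_tmul]

/-- Scaling by the polynomial variable separates the degrees, and the `m`-th coefficient picks out
one of them. This works over every commutative ring. -/
theorem exists_liePowerProj (m : ℕ) : ∃ q : FreeLie R A →ₗ[R] liePower R A m,
    (∀ z : liePower R A m, q z = z) ∧ ∀ m', m' ≠ m → ∀ z ∈ liePower R A m', q z = 0 := by
  obtain ⟨q, hq⟩ := exists_scaling (R := R) (A := A) (Polynomial.X : Polynomial R)
    (Polynomial.lcoeff R m)
  have hq' : ∀ m', ∀ z ∈ liePower R A m', q z = if m = m' then z else 0 := by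
    intro m' z hz
    rw [hq m' z hz, Polynomial.lcoeff_apply, Polynomial.coeff_X_pow, ite_smul, one_smul, zero_smul]
  have hmem : ∀ z, q z ∈ liePower R A m := by
    intro z
    induction mem_iSup_liePower z using Submodule.iSup_induction' with
    | zero => rw [map_zero]; exact zero_mem _
    | add a b _ _ ha hb => rw [map_add]; exact add_mem ha hb
    | mem p x hx =>
      rw [hq' p x hx]
      split_ifs with h
      · exact h ▸ hx
      · exact zero_mem _
  refine ⟨q.codRestrict _ hmem, fun z => Subtype.ext ?_, fun m' hm z hz => Subtype.ext ?_⟩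
  · exact (hq' m z.1 z.2).trans (if_pos rfl)
  · exact (hq' m' z hz).trans (if_neg hm.symm)

variable (R A) in
/-- The projection of the free Lie algebra to a Lie power. -/
noncomputable def liePowerProj (m : ℕ) : FreeLie R A →ₗ[R] liePower R A m :=
  (exists_liePowerProj m).choose

theorem liePowerProj_self (m : ℕ) (z : liePower R A m) : liePowerProj R A m z = z :=
  (exists_liePowerProj m).choose_spec.1 z

theorem liePowerProj_of_ne {m m' : ℕ} (h : m' ≠ m) {z : FreeLie R A} (hz : z ∈ liePower R A m') :
    liePowerProj R A m z = 0 :=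
  (exists_liePowerProj m).choose_spec.2 m' h z hz

end Projections

section CePartMul

variable {R : Type u} [CommRing R] {𝔤 : Type w} [LieRing 𝔤] [LieAlgebra R 𝔤]
  {𝒢 : ℕ → Submodule R 𝔤}

theorem mul_mem_cePart {n i m j : ℕ} {a b : ExteriorAlgebra R 𝔤} (ha : a ∈ cePart R 𝒢 n i)
    (hb : b ∈ cePart R 𝒢 m j) : a * b ∈ cePart R 𝒢 (n + m) (i + j) := by
  refine cePart_le_of_ι_mul
    (fun n i => (cePart R 𝒢 (n + m) (i + j)).comap (LinearMap.mulRight R b)) ?_ ?_ n i ha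
  · simpa using hb
  · intro p n i z hz ω _ hω
    change ω * b ∈ cePart R 𝒢 (n + m) (i + j) at hω
    change ExteriorAlgebra.ι R z * ω * b ∈ cePart R 𝒢 (p + n + m) (i + 1 + j)
    rw [mul_assoc, add_assoc p n m, add_right_comm]
    exact ι_mul_mem_cePart hz hω

theorem prod_ofFn_mem_cePart {n : ℕ} (f : Fin n → ExteriorAlgebra R 𝔤) (wt dg : Fin n → ℕ)
    (h : ∀ j, f j ∈ cePart R 𝒢 (wt j) (dg j)) :
    (List.ofFn f).prod ∈ cePart R 𝒢 (∑ j, wt j) (∑ j, dg j) := by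
  induction n with
  | zero => simpa using one_mem_cePart
  | succ n ih =>
    rw [List.ofFn_succ, List.prod_cons, Fin.sum_univ_succ, Fin.sum_univ_succ]
    exact mul_mem_cePart (h 0) (ih _ _ _ fun j => h j.succ)

theorem map_mem_cePart {N : Type w'} [AddCommGroup N] [Module R N] {f : N →ₗ[R] 𝔤} {m k : ℕ}
    (hf : ∀ x, f x ∈ 𝒢 m) {ω : ExteriorAlgebra R N} (hω : ω ∈ ⋀[R]^k N) :
    ExteriorAlgebra.map f ω ∈ cePart R 𝒢 (m * k) k := by
  rw [← ExteriorAlgebra.ιMulti_span_fixedDegree] at hω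
  refine (Submodule.span_le.2 ?_ : _ ≤
    (cePart R 𝒢 (m * k) k).comap (ExteriorAlgebra.map f).toLinearMap) hω
  rintro _ ⟨x, rfl⟩
  exact Submodule.subset_span ⟨fun j => f (x j), fun _ => m, fun j => hf (x j),
    by simp [mul_comm], (ExteriorAlgebra.map_apply_ιMulti f x).symm⟩

end CePartMul

theorem coe_exteriorPower_map {R : Type u} [CommRing R] {M : Type v} [AddCommGroup M] [Module R M]
    {N : Type w} [AddCommGroup N] [Module R N] (k : ℕ) (f : M →ₗ[R] N) (ω : ⋀[R]^k M) :
    (exteriorPower.map k f ω : ExteriorAlgebra R N) = ExteriorAlgebra.map f ω := by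
  have : (⋀[R]^k N).subtype ∘ₗ exteriorPower.map k f =
      (ExteriorAlgebra.map f).toLinearMap ∘ₗ (⋀[R]^k M).subtype := by
    refine exteriorPower.linearMap_ext (AlternatingMap.ext fun x => ?_)
    change (exteriorPower.map k f (exteriorPower.ιMulti R k x) : ExteriorAlgebra R N) =
      ExteriorAlgebra.map f (ExteriorAlgebra.ιMulti R k x)
    rw [exteriorPower.map_apply_ιMulti, ExteriorAlgebra.map_apply_ιMulti]
    rfl
  exact LinearMap.congr_fun this ω

/-! ### Sums of homogeneous tensors inside the exterior algebra -/

section HomSum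

variable {R : Type u} [CommRing R] {n : ℕ} {N : Fin n → Type w} [∀ j, AddCommGroup (N j)]
  [∀ j, Module R (N j)]

section Mul

variable {M : Type w'} [AddCommGroup M] [Module R M] {T : Type*} [DecidableEq T]

/-- Exterior multiplication on a direct sum of homogeneous tensors. -/
noncomputable def homSumMul (incl : ∀ j, N j →ₗ[R] M) (κ : T → Fin n → ℕ) :
    (⨁ t, HomTensor R N (κ t)) →ₗ[R] ExteriorAlgebra R M :=
  DirectSum.toModule R T _ fun t => extMul incl ∘ₗ homIncl (κ t)

theorem homSumMul_lof (incl : ∀ j, N j →ₗ[R] M) (κ : T → Fin n → ℕ) (t : T)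
    (τ : HomTensor R N (κ t)) :
    homSumMul incl κ (DirectSum.lof R T (fun t => HomTensor R N (κ t)) t τ) =
      extMul incl (homIncl (κ t) τ) :=
  DirectSum.toModule_lof R (M := fun t => HomTensor R N (κ t))
    (φ := fun t => extMul incl ∘ₗ homIncl (κ t)) t τ

theorem homSumMul_lof_tprod (incl : ∀ j, N j →ₗ[R] M) (κ : T → Fin n → ℕ) (t : T)
    (ω : ∀ j, ⋀[R]^(κ t j) (N j)) :
    homSumMul incl κ (DirectSum.lof R T (fun t => HomTensor R N (κ t)) t
        (PiTensorProduct.tprod R ω)) =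
      (List.ofFn fun j => ExteriorAlgebra.map (incl j) (ω j).1).prod := by
  rw [homSumMul_lof, homIncl_tprod, extMul_tprod]

/-- Acting on the unit tensor undoes multiplication, and the projection to multidegree `κ t` then
recovers the component at `t`, because different indices have different multidegrees. -/
theorem homSumMul_injective {incl : ∀ j, N j →ₗ[R] M} {pr : ∀ j, M →ₗ[R] N j}
    (h : ∀ j x, pr j (incl j x) = x) (h' : ∀ i j x, i ≠ j → pr i (incl j x) = 0)
    {κ : T → Fin n → ℕ} (hκ : Function.Injective κ) : Function.Injective (homSumMul incl κ) := by
  have key : ∀ (x : ⨁ t, HomTensor R N (κ t)) (t : T),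
      homProj (κ t) (extAction pr (homSumMul incl κ x) (PiTensorProduct.tprod R fun _ => 1)) =
        x t := by
    intro x t
    induction x using DirectSum.induction_on with
    | zero => rw [map_zero, map_zero, LinearMap.zero_apply, map_zero]; rfl
    | add x y hx hy => rw [map_add, map_add, LinearMap.add_apply, map_add, hx, hy]; rfl
    | of s y =>
      have := homSumMul_lof incl κ s y
      rw [DirectSum.lof_eq_of] at this
      rw [this, extAction_extMul h h']
      by_cases hst : s = t
      · subst hst
        rw [homProj_homIncl_self, DirectSum.of_eq_same]
      · rw [homProj_homIncl_of_ne (fun h => hst (hκ h)),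
          DirectSum.of_eq_of_ne _ _ _ (Ne.symm hst)]
  intro x y hxy
  refine DFinsupp.ext fun t => ?_
  rw [← key x t, ← key y t, hxy]

end Mul

/-! The homogeneous tensors of given weight and degree, the `j`-th factor being of weight `j + 1`. -/

variable (R N) in
/-- The homogeneous tensors of total weight `p` and total degree `i`. -/
noncomputable def weightDegreePart (p i : ℕ) : Submodule R (ExtTensor R N) :=
  ⨆ k : {k : Fin n → ℕ // ∑ j, k j = i ∧ ∑ j : Fin n, ((j : ℕ) + 1) * k j = p},
    LinearMap.range (homIncl (R := R) (N := N) k.1)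

theorem one_mem_weightDegreePart :
    PiTensorProduct.tprod R (fun _ => 1) ∈ weightDegreePart R N 0 0 := by
  refine Submodule.mem_iSup_of_mem ⟨0, by simp, by simp⟩ (tprod_mem_range_homIncl fun j => ?_)
  change (1 : ExteriorAlgebra R (N j)) ∈ LinearMap.range (ExteriorAlgebra.ι R) ^ 0
  rw [pow_zero]
  exact Submodule.mem_one.2 ⟨1, map_one _⟩

theorem insertOp_mem_weightDegreePart {p i : ℕ} (j : Fin n) (x : N j) {τ : ExtTensor R N}
    (hτ : τ ∈ weightDegreePart R N p i) :
    insertOp j x τ ∈ weightDegreePart R N (j + 1 + p) (i + 1) := by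
  refine (iSup_le ?_ : weightDegreePart R N p i ≤ (weightDegreePart R N (j + 1 + p)
    (i + 1)).comap (insertOp j x)) hτ
  rintro ⟨k, rfl, rfl⟩ τ hτ
  refine Submodule.mem_iSup_of_mem ⟨k + Pi.single j 1, ?_, ?_⟩ (insertOp_mem_range_homIncl j x hτ)
  · simp [Finset.sum_add_distrib]
  · simp [mul_add, Finset.sum_add_distrib, Pi.single_apply, add_comm]

variable {𝔤 : Type w'} [LieRing 𝔤] [LieAlgebra R 𝔤] {𝒢 : ℕ → Submodule R 𝔤}

theorem cePart_le_range_homSumMul (h0 : 𝒢 0 = ⊥) {incl : ∀ j, N j →ₗ[R] 𝔤}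
    (hincl : ∀ j : Fin n, 𝒢 (j + 1) ≤ LinearMap.range (incl j)) (i : ℕ) :
    cePart R 𝒢 n i ≤ LinearMap.range (homSumMul incl fun k : Tuples n i => k.1) := by
  -- Only factors of weight 1 to `n` are available, so nothing is claimed in weights above `n`. A
  -- wedge of weight at most `n` needs no others, as weight zero vectors vanish.
  let P : ℕ → ℕ → Submodule R (ExteriorAlgebra R 𝔤) := fun p i =>
    if p ≤ n then (weightDegreePart R N p i).map (extMul incl) else ⊤
  have hP : cePart R 𝒢 n i ≤ P n i := by
    refine cePart_le_of_ι_mul P ?_ ?_ n i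
    · dsimp only [P]
      rw [if_pos n.zero_le]
      refine ⟨_, one_mem_weightDegreePart, ?_⟩
      rw [extMul_tprod]
      simp
    · intro a p i z hz ω _ hω
      dsimp only [P] at hω ⊢
      split_ifs with hap
      · rw [if_pos (by omega)] at hω
        obtain ⟨τ, hτ, rfl⟩ := hω
        cases a with
        | zero =>
          rw [h0, Submodule.mem_bot] at hz
          rw [hz, map_zero, zero_mul]
          exact zero_mem _
        | succ a =>
          obtain ⟨x, rfl⟩ := hincl ⟨a, by omega⟩ hz
          exact ⟨_, insertOp_mem_weightDegreePart ⟨a, by omega⟩ x hτ, extMul_insertOp _ _ x τ⟩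
      · trivial
  refine hP.trans ?_
  dsimp only [P]
  rw [if_pos le_rfl, Submodule.map_le_iff_le_comap]
  refine iSup_le fun k => ?_
  rintro _ ⟨τ, rfl⟩
  exact ⟨_, homSumMul_lof incl (fun k : Tuples n i => k.1) k τ⟩

theorem homSumMul_mem {incl : ∀ j, N j →ₗ[R] 𝔤} (hincl : ∀ (j : Fin n) x, incl j x ∈ 𝒢 (j + 1))
    (i : ℕ) (x : ⨁ k : Tuples n i, HomTensor R N k.1) :
    homSumMul incl (fun k : Tuples n i => k.1) x ∈ cePart R 𝒢 n i := by
  induction x using DirectSum.induction_on with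
  | zero => rw [map_zero]; exact zero_mem _
  | add x y hx hy => rw [map_add]; exact add_mem hx hy
  | of k y =>
    induction y using PiTensorProduct.induction_on with
    | smul_tprod r ω =>
      rw [← DirectSum.lof_eq_of R, map_smul, map_smul]
      refine Submodule.smul_mem _ _ ?_
      rw [homSumMul_lof_tprod incl fun k : Tuples n i => k.1]
      have := prod_ofFn_mem_cePart (𝒢 := 𝒢)
        (fun j : Fin n => ExteriorAlgebra.map (incl j) (ω j).1)
        (fun j => (j + 1) * k.1 j) k.1 fun j => map_mem_cePart (hincl j) (ω j).2
      rwa [k.2.1, k.2.2] at this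
    | add a b ha hb =>
      rw [map_add, map_add]
      exact add_mem ha hb

end HomSum

/-! ### Exterior multiplication for the Lie powers -/

section TermSum

variable {R : Type u} [CommRing R] {A : Type v} [AddCommGroup A] [Module R A]

variable (R A) in
/-- Exterior multiplication on the direct sum of the tensor terms. -/
noncomputable def termMul (n i : ℕ) : TermSum R A n i →ₗ[R] ExteriorAlgebra R (FreeLie R A) :=
  homSumMul (N := fun j : Fin n => liePower R A (j + 1))
    (fun j : Fin n => (liePower R A (j + 1)).subtype) fun k : Tuples n i => k.1

theorem termMul_lof_tprod (n i : ℕ) (k : Tuples n i)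
    (ω : ∀ j : Fin n, ⋀[R]^(k.1 j) (liePower R A (j + 1))) :
    termMul R A n i (DirectSum.lof R (Tuples n i) (fun k => TensorTerm R A k.1) k
        (PiTensorProduct.tprod R ω)) =
      (List.ofFn fun j : Fin n =>
        ExteriorAlgebra.map (liePower R A (j + 1)).subtype (ω j).1).prod :=
  homSumMul_lof_tprod (N := fun j : Fin n => liePower R A (j + 1))
    (fun j : Fin n => (liePower R A (j + 1)).subtype) (fun k : Tuples n i => k.1) k ω

theorem termMul_injective (n i : ℕ) : Function.Injective (termMul R A n i) :=
  homSumMul_injective (N := fun j : Fin n => liePower R A (j + 1))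
    (incl := fun j : Fin n => (liePower R A (j + 1)).subtype)
    (pr := fun j : Fin n => liePowerProj R A (j + 1))
    (fun _ x => liePowerProj_self _ x)
    (fun _ _ x hij => liePowerProj_of_ne (fun h => hij (Fin.ext (by omega))) x.2)
    Subtype.val_injective

theorem termMul_mem (n i : ℕ) (x : TermSum R A n i) :
    termMul R A n i x ∈ cePart R (liePower R A) n i :=
  homSumMul_mem (N := fun j : Fin n => liePower R A (j + 1))
    (incl := fun j : Fin n => (liePower R A (j + 1)).subtype) (fun _ x => x.2) i x

theorem cePart_le_range_termMul (n i : ℕ) :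
    cePart R (liePower R A) n i ≤ LinearMap.range (termMul R A n i) :=
  cePart_le_range_homSumMul (N := fun j : Fin n => liePower R A (j + 1))
    (incl := fun j : Fin n => (liePower R A (j + 1)).subtype) (liePower_zero R A)
    (fun j => (Submodule.range_subtype (liePower R A (j + 1))).ge) i

variable (R A) in
/-- Exterior multiplication is an isomorphism onto the graded piece. -/
noncomputable def termEquiv (n i : ℕ) : TermSum R A n i ≃ₗ[R] cePart R (liePower R A) n i :=
  LinearEquiv.ofBijective ((termMul R A n i).codRestrict _ (termMul_mem n i))
    ⟨fun x y h => termMul_injective n i (congrArg Subtype.val h), fun ω => by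
      obtain ⟨x, hx⟩ := cePart_le_range_termMul n i ω.2
      exact ⟨x, Subtype.ext hx⟩⟩

theorem termEquiv_termMap {B : Type v} [AddCommGroup B] [Module R B] (f : A →ₗ[R] B) (n i : ℕ)
    (x : TermSum R A n i) :
    termEquiv R B n i (termMap f n i x) = ceMap f n i (termEquiv R A n i x) := by
  refine Subtype.ext ?_
  change termMul R B n i (termMap f n i x) =
    ExteriorAlgebra.map (FreeLie.map f : FreeLie R A →ₗ[R] FreeLie R B) (termMul R A n i x)
  induction x using DirectSum.induction_on with
  | zero => simp
  | add x y hx hy => simp only [map_add, hx, hy]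
  | of k y =>
    induction y using PiTensorProduct.induction_on with
    | smul_tprod r ω =>
      rw [← DirectSum.lof_eq_of R, map_smul, map_smul, map_smul, map_smul, map_smul]
      congr 1
      rw [termMul_lof_tprod, termMap, DirectSum.lmap_lof, PiTensorProduct.map_tprod,
        termMul_lof_tprod, map_list_prod, List.map_ofFn]
      congr 2
      funext j
      rw [coe_exteriorPower_map]
      change ExteriorAlgebra.map (liePower R B (j + 1)).subtype
          (ExteriorAlgebra.map (liePowerMap f (j + 1)) (ω j).1) =
        ExteriorAlgebra.map (FreeLie.map f : FreeLie R A →ₗ[R] FreeLie R B)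
          (ExteriorAlgebra.map (liePower R A (j + 1)).subtype (ω j).1)
      rw [← AlgHom.comp_apply, ← AlgHom.comp_apply, ExteriorAlgebra.map_comp_map,
        ExteriorAlgebra.map_comp_map]
      rfl
    | add a b ha hb => simp only [map_add, ha, hb]

end TermSum

section Functor

variable (R : Type u) [CommRing R]

/-- Exterior multiplication is an isomorphism of functors. -/
noncomputable def termIso (n i : ℕ) : termFunctor.{u, v} R n i ≅ ceFunctor R n i :=
  NatIso.ofComponents (fun A => (termEquiv R A.obj n i).toModuleIso) fun f => by
    ext x
    exact termEquiv_termMap f.hom.hom n i x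

end Functor

/-! ### The top and the bottom degree -/

section Ends

variable {R : Type u} [CommRing R] {A : Type v} [AddCommGroup A] [Module R A]

/-- With the zero bracket `A` is a Lie algebra, and the identity extends to `L^*(A)`. The retraction
makes the induced map of exterior algebras injective. -/
theorem exists_retraction_of : ∃ r : FreeLie R A →ₗ[R] A, r ∘ₗ FreeLie.of R A = LinearMap.id := by
  let _ : LieRing A :=
    { (inferInstance : AddCommGroup A) with
      bracket := fun _ _ => 0
      add_lie := fun _ _ _ => (add_zero 0).symm
      lie_add := fun _ _ _ => (add_zero 0).symm
      lie_self := fun _ => rfl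
      leibniz_lie := fun _ _ _ => (add_zero 0).symm }
  let _ : LieAlgebra R A :=
    { (inferInstance : Module R A) with
      lie_smul := fun r _ _ => (smul_zero r).symm }
  exact ⟨(FreeLie.lift (LinearMap.id : A →ₗ[R] A) : FreeLie R A →ₗ[R] A),
    LinearMap.ext fun a => FreeLie.lift_of _ a⟩

theorem mem_liePower_one {z : FreeLie R A} (hz : z ∈ liePower R A 1) :
    ∃ a, FreeLie.of R A a = z := by
  have hpos : ∀ (m : ℕ) (z : FreeLie R A), IsCommutator R A m z → 0 < m := by
    intro m z hz
    induction hz with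
    | of a => exact one_pos
    | lie _ _ h _ => exact Nat.add_pos_left h _
  have h : ∀ (m : ℕ) (z : FreeLie R A), IsCommutator R A m z → m = 1 →
      z ∈ LinearMap.range (FreeLie.of R A) := by
    intro m z hz
    induction hz with
    | of a => exact fun _ => ⟨a, rfl⟩
    | lie hx hy _ _ =>
      intro hm
      have := hpos _ _ hx
      have := hpos _ _ hy
      omega
  exact (Submodule.span_le.2 fun z hz => h 1 z hz rfl :
    liePower R A 1 ≤ LinearMap.range (FreeLie.of R A)) hz

theorem map_of_mem_cePart (n : ℕ) (ω : ⋀[R]^n A) :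
    ExteriorAlgebra.map (FreeLie.of R A) ω ∈ cePart R (liePower R A) n n := by
  have := map_mem_cePart (𝒢 := liePower R A) (m := 1) (f := FreeLie.of R A)
    (fun a => Submodule.subset_span (IsCommutator.of a)) ω.2
  rwa [one_mul] at this

/-- If `n` positive integers have sum `n`, all of them are 1, so every factor of the wedge comes
from `A`. -/
theorem exists_map_of_eq {n : ℕ} {ω : ExteriorAlgebra R (FreeLie R A)}
    (hω : ω ∈ cePart R (liePower R A) n n) :
    ∃ η : ⋀[R]^n A, ExteriorAlgebra.map (FreeLie.of R A) η = ω := by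
  refine (Submodule.span_le.2 ?_ : _ ≤ LinearMap.range
    ((ExteriorAlgebra.map (FreeLie.of R A)).toLinearMap ∘ₗ (⋀[R]^n A).subtype)) hω
  rintro _ ⟨x, deg, hx, hdeg, rfl⟩
  -- A zero vector belongs to every Lie power and may carry the degree 0, so this case is removed
  -- before positivity is claimed.
  by_cases h0 : ∃ k, x k = 0
  · obtain ⟨k, hk⟩ := h0
    rw [(ExteriorAlgebra.ιMulti R n).map_coord_zero k hk]
    exact zero_mem _
  · have hpos : ∀ k ∈ Finset.univ, 1 ≤ deg k := by
      intro k _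
      by_contra hk
      refine h0 ⟨k, ?_⟩
      have := hx k
      rwa [Nat.lt_one_iff.1 (not_le.1 hk), liePower_zero, Submodule.mem_bot] at this
    have hone := (Finset.sum_eq_sum_iff_of_le hpos).1 (by simp [hdeg])
    choose a ha using fun k => mem_liePower_one (by rw [hone k (Finset.mem_univ k)]; exact hx k)
    refine ⟨exteriorPower.ιMulti R n a, ?_⟩
    change ExteriorAlgebra.map (FreeLie.of R A) (ExteriorAlgebra.ιMulti R n a) = _
    rw [ExteriorAlgebra.map_apply_ιMulti]
    congr 1
    exact funext ha

variable (R A) in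
/-- The top degree is the exterior power. -/
noncomputable def topEquiv (n : ℕ) : ⋀[R]^n A ≃ₗ[R] cePart R (liePower R A) n n :=
  LinearEquiv.ofBijective (((ExteriorAlgebra.map (FreeLie.of R A)).toLinearMap ∘ₗ
      (⋀[R]^n A).subtype).codRestrict _ (map_of_mem_cePart n))
    ⟨fun _ _ h => Subtype.ext
      (ExteriorAlgebra.map_injective exists_retraction_of (congrArg Subtype.val h)), fun ω => by
      obtain ⟨η, hη⟩ := exists_map_of_eq ω.2
      exact ⟨η, Subtype.ext hη⟩⟩

theorem topEquiv_coe (n : ℕ) (ω : ⋀[R]^n A) :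
    (topEquiv R A n ω : ExteriorAlgebra R (FreeLie R A)) =
      ExteriorAlgebra.map (FreeLie.of R A) ω :=
  rfl

variable (R A) in
/-- Degree one is the Lie power. -/
noncomputable def bottomEquiv (n : ℕ) : liePower R A n ≃ₗ[R] cePart R (liePower R A) n 1 :=
  LinearEquiv.ofBijective ((ExteriorAlgebra.ι R ∘ₗ (liePower R A n).subtype).codRestrict _
      fun x => ι_mem_cePart x.2)
    ⟨fun _ _ h => Subtype.ext
      (ExteriorAlgebra.ι_leftInverse.injective (congrArg Subtype.val h)), fun ω => by
      obtain ⟨z, hz, hzω⟩ := mem_cePart_one ω.2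
      exact ⟨⟨z, hz⟩, Subtype.ext hzω⟩⟩

theorem bottomEquiv_coe (n : ℕ) (x : liePower R A n) :
    (bottomEquiv R A n x : ExteriorAlgebra R (FreeLie R A)) =
      ExteriorAlgebra.ι R (x : FreeLie R A) :=
  rfl

variable {B : Type v} [AddCommGroup B] [Module R B] (f : A →ₗ[R] B)

theorem topEquiv_map (n : ℕ) (ω : ⋀[R]^n A) :
    topEquiv R B n (exteriorPower.map n f ω) = ceMap f n n (topEquiv R A n ω) := by
  refine Subtype.ext ?_
  rw [topEquiv_coe, coe_exteriorPower_map]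
  change _ = ExteriorAlgebra.map (FreeLie.map f : FreeLie R A →ₗ[R] FreeLie R B)
    (ExteriorAlgebra.map (FreeLie.of R A) ω.1)
  rw [← AlgHom.comp_apply, ← AlgHom.comp_apply, ExteriorAlgebra.map_comp_map,
    ExteriorAlgebra.map_comp_map]
  congr 2
  exact LinearMap.ext fun a => (FreeLie.map_of f a).symm

theorem bottomEquiv_map (n : ℕ) (x : liePower R A n) :
    bottomEquiv R B n (liePowerMap f n x) = ceMap f n 1 (bottomEquiv R A n x) :=
  Subtype.ext (ExteriorAlgebra.map_apply_ι
    (FreeLie.map f : FreeLie R A →ₗ[R] FreeLie R B) x.1).symm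

end Ends

section Functor

variable (R : Type u) [CommRing R]

/-- The inclusion `A → L^*(A)` induces an isomorphism of the exterior power with the top degree. -/
noncomputable def topIso (n : ℕ) : extPowerFunctor.{u, v} R n ≅ ceFunctor R n n :=
  NatIso.ofComponents (fun A => (topEquiv R A.obj n).toModuleIso) fun f => by
    refine ModuleCat.hom_ext (LinearMap.ext fun x => ?_)
    exact topEquiv_map f.hom.hom n x

/-- The inclusion `L^n(A) → L^*(A)` induces an isomorphism of the Lie power with degree one. -/
noncomputable def bottomIso (n : ℕ) : liePowerFunctor.{u, v} R n ≅ ceFunctor R n 1 :=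
  NatIso.ofComponents (fun A => (bottomEquiv R A.obj n).toModuleIso) fun f => by
    refine ModuleCat.hom_ext (LinearMap.ext fun x => ?_)
    exact bottomEquiv_map f.hom.hom n x

end Functor

end GradedCE

open GradedCE in
theorem mainTheorem3 (R : Type u) [CommRing R] (n : ℕ) (hn : 2 ≤ n) :
    (ceComplex.{u, v} R n).Acyclic ∧
    (∀ i : ℕ, ∃ e : termFunctor.{u, v} R n i ≅ (ceComplex.{u, v} R n).X i,
      ∀ (A : FMod.{u, v} R) (k : Tuples n i)
        (ω : ∀ j : Fin n, ⋀[R]^(k.1 j) (liePower R A.obj (j + 1))),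
        ((e.hom.app A).hom (DirectSum.lof R (Tuples n i) (fun k => TensorTerm R A.obj k.1) k
            (PiTensorProduct.tprod R ω)) : cePart R (liePower R A.obj) n i).1 =
          (List.ofFn fun j : Fin n =>
            ExteriorAlgebra.map (liePower R A.obj (j + 1)).subtype (ω j).1).prod) ∧
    (∀ i : ℕ, i = 0 ∨ n < i → CategoryTheory.Limits.IsZero ((ceComplex.{u, v} R n).X i)) ∧
    (∃ e : extPowerFunctor.{u, v} R n ≅ (ceComplex.{u, v} R n).X n,
      ∀ (A : FMod.{u, v} R) (a : Fin n → A.obj),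
        ((e.hom.app A).hom (exteriorPower.ιMulti R n a) : cePart R (liePower R A.obj) n n).1 =
          ExteriorAlgebra.ιMulti R n fun j => FreeLie.of R A.obj (a j)) ∧
    (∃ e : liePowerFunctor.{u, v} R n ≅ (ceComplex.{u, v} R n).X 1,
      ∀ (A : FMod.{u, v} R) (x : liePower R A.obj n),
        ((e.hom.app A).hom x : cePart R (liePower R A.obj) n 1).1 =
          ExteriorAlgebra.ι R (x : FreeLie R A.obj)) :=
  ⟨ceComplex_acyclic R hn, fun i => ⟨termIso R n i, fun _ k ω => termMul_lof_tprod n i k ω⟩,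
    fun _ h => ceComplex_isZero R hn h,
    ⟨topIso R n, fun _ a => ExteriorAlgebra.map_apply_ιMulti _ a⟩,
    ⟨bottomIso R n, fun _ x => bottomEquiv_coe n x⟩⟩
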